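/- Let $\Omega\subset\mathbb R^N$ be a bounded open set (for instance a bounded smooth domain), let $m\ge 1$, and let $H^m_0(\Omega)$ be the closure of $C_c^\infty(\Omega)$ in the $H^m$-norm. By an eigenvalue $\mu$ of $(-\Delta)^m$ we mean a Dirichlet eigenvalue: the eigenspace $E_\mu=\{u\in H^m_0(\Omega): (-\Delta)^m u=\mu u \text{ weakly in }\Omega\}$ is non-zero; its dimension is the multiplicity of $\mu$. Fix an eigenvalue $\lambda_l$ and consider $$V'(\psi)=-(-\Delta)^m\psi+\lambda_l\psi-\Big(\int_\Omega\psi^2\Big)\psi ,\qquad \psi\in H^m_0(\Omega)$$ (for $m=1$: $\Delta\psi+\lambda_l\psi-(\int\psi^2)\psi$ with zero Dirichlet condition). Let $\Phi$ be the set of equilibria, i.e. of weak solutions $\psi\in H^m_0(\Omega)$ of $V'(\psi)=0$, and let $V''(\psi)$ be the Fréchet derivative of $V'$ at $\psi$ (tested against functions in $C_c^\infty(\Omega)$). Then: 1. Hypothesis $(\mathbf H_R)$ holds: if branching occurs at $\psi\in\Phi$ (that is, $\psi$ is not isolated in $\Phi$) and $\dim\ker V''(\psi)=k\ge1$, then $\Phi$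 is, in a neighbourhood of $\psi$ in $H^m_0(\Omega)$, a smooth $k$-dimensional embedded submanifold. Moreover $\ker V''(\psi)$ is finite-dimensional for every $\psi\in\Phi$. 2. For all $\psi,v\in H^m_0(\Omega)$, in the weak sense, $$V''(\psi)v=-(-\Delta)^m v+\lambda_l v-2\psi\int_\Omega\psi v-v\int_\Omega\psi^2 .$$ 3. Let $\lambda_j<\lambda_l$ be an eigenvalue of multiplicity $k+1\ge2$, let $\psi_{j,1},\dots,\psi_{j,k+1}\in E_{\lambda_j}$ be orthonormal in $L^2(\Omega)$, and put $$S_k=\Big\{\sum_{i=1}^{k+1}c_i\psi_{j,i}\;:\;\sum_{i=1}^{k+1} c_i^2=\lambda_l-\lambda_j\Big\}.$$ A combination $\sum_i c_i\psi_{j,i}$ is an equilibrium if and only if $c=0$ or $\sum_i c_i^2=\lambda_l-\lambda_j$, and the sphere $S_k$ is a smooth $k$-dimensional embedded submanifold of $H^m_0(\Omega)$. For every $\hat\psi=\sum_i\hat c_i\psi_{j,i}\in S_k$: branching occurs at $\hat\psi$; there is $\varepsilon>0$ such that a $\psi\in H^m_0(\Omega)$ with $\|\psi-\hat\psi\|_{L^2(\Omega)}<\varepsilon$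 is an equilibrium if and only if $\psi\in S_k$; $S_k$ is the connected component of $\hat\psi$ in $\Phi$; and $$\ker V''(\hat\psi)=\Big\{\sum_{i=1}^{k+1}b_i\psi_{j,i}\;:\;\sum_{i=1}^{k+1} b_i\hat c_i=0\Big\},$$ which has dimension exactly $k$. -/

import Mathlib

open MeasureTheory Topology TopologicalSpace Filter
open scoped ContDiff Distributions LineDeriv

noncomputable section

namespace NonlocalResonance

/-! ### Test functions and the polyharmonic operator -/

/-- The Euclidean space `ℝ^N`. -/
abbrev Space (N : ℕ) : Type := EuclideanSpace ℝ (Fin N)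

/-- The `i`-th coordinate vector of `ℝ^N`. -/
def coordVec {N : ℕ} (i : Fin N) : Space N := EuclideanSpace.single i 1

/-- The real Hilbert space `L²(Ω)`. -/
abbrev L2 {N : ℕ} (Ω : Opens (Space N)) : Type :=
  Lp ℝ 2 (volume.restrict (Ω : Set (Space N)))

theorem memLp_test {N : ℕ} (Ω : Opens (Space N)) (φ : 𝓓(Ω, ℝ)) :
    MemLp φ 2 (volume.restrict (Ω : Set (Space N))) :=
  φ.continuous.memLp_of_hasCompactSupport φ.hasCompactSupport

/-- The inclusion `C_c^∞(Ω) → L²(Ω)`. -/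
def testToL2 {N : ℕ} (Ω : Opens (Space N)) : 𝓓(Ω, ℝ) →ₗ[ℝ] L2 Ω where
  toFun φ := (memLp_test Ω φ).toLp φ
  map_add' _ _ := rfl
  map_smul' _ _ := rfl

/-- The Laplacian `∑ᵢ ∂ᵢ∂ᵢ` as a linear map `C_c^∞(Ω) → C_c^∞(Ω)`. -/
def testLaplacian {N : ℕ} (Ω : Opens (Space N)) : Module.End ℝ 𝓓(Ω, ℝ) where
  toFun φ := ∑ i : Fin N, ∂_{coordVec i} (∂_{coordVec i} φ)
  map_add' φ χ := by simp [LineDeriv.lineDerivOp_add, Finset.sum_add_distrib]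
  map_smul' c φ := by simp [LineDeriv.lineDerivOp_smul, Finset.smul_sum]

/-- The polyharmonic operator `(-Δ)^m` on test functions. -/
def polyLaplacian {N : ℕ} (Ω : Opens (Space N)) (m : ℕ) : Module.End ℝ 𝓓(Ω, ℝ) :=
  (-testLaplacian Ω) ^ m

/-! ### The space `H^m_0(Ω)` -/

/-- Indices of the partial derivatives `∂_{i₁} ⋯ ∂_{i_r}`, `0 ≤ r ≤ m`. -/
abbrev JetIndex (N m : ℕ) : Type := Σ r : Fin (m + 1), (Fin (r : ℕ) → Fin N)

/-- The index of the derivative of order zero. -/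
def zeroIndex (N m : ℕ) : JetIndex N m := ⟨0, Fin.elim0⟩

/-- The Hilbert sum of copies of `L²(Ω)`, one for each partial derivative of order at most `m`. -/
abbrev JetSpace {N : ℕ} (Ω : Opens (Space N)) (m : ℕ) : Type :=
  PiLp 2 (fun _ : JetIndex N m => L2 Ω)

/-- The map `φ ↦ (∂_{i₁} ⋯ ∂_{i_r} φ)_{r ≤ m}`; the norm of the image is the `H^m`-norm of `φ`. -/
def jet {N : ℕ} (Ω : Opens (Space N)) (m : ℕ) : 𝓓(Ω, ℝ) →ₗ[ℝ] JetSpace Ω m where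
  toFun φ := WithLp.toLp 2 (fun i => testToL2 Ω (∂^{fun a => coordVec (i.2 a)} φ))
  map_add' φ χ := by
    ext1 i
    simp [LineDeriv.iteratedLineDerivOp_add]
  map_smul' c φ := by
    ext1 i
    simp [LineDeriv.iteratedLineDerivOp_smul]

/-- `H^m_0(Ω)`: the closure of `C_c^∞(Ω)` in the `H^m`-norm. An element is recorded together with
its weak derivatives of order at most `m`, which are the `L²`-limits of those of test functions. -/
def Hm0 {N : ℕ} (Ω : Opens (Space N)) (m : ℕ) : Submodule ℝ (JetSpace Ω m) :=
  (LinearMap.range (jet Ω m)).topologicalClosure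

/-- The function in `L²(Ω)` underlying an element of `H^m_0(Ω)`. -/
def toL2 {N : ℕ} {Ω : Opens (Space N)} {m : ℕ} : Hm0 Ω m →L[ℝ] L2 Ω :=
  (PiLp.proj 2 (fun _ : JetIndex N m => L2 Ω) (zeroIndex N m)).comp (Hm0 Ω m).subtypeL

/-- `∫_Ω u φ` for `u ∈ H^m_0(Ω)` and a test function `φ`. -/
def pairing {N : ℕ} {Ω : Opens (Space N)} {m : ℕ} (u : Hm0 Ω m) (φ : 𝓓(Ω, ℝ)) : ℝ :=
  ∫ x in (Ω : Set (Space N)), toL2 u x * φ x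

/-- `∫_Ω u v` for `u, v ∈ H^m_0(Ω)`. -/
def integralMul {N : ℕ} {Ω : Opens (Space N)} {m : ℕ} (u v : Hm0 Ω m) : ℝ :=
  ∫ x in (Ω : Set (Space N)), toL2 u x * toL2 v x

theorem pairing_eq_inner {N : ℕ} {Ω : Opens (Space N)} {m : ℕ} (u : Hm0 Ω m) (φ : 𝓓(Ω, ℝ)) :
    pairing u φ = inner ℝ (testToL2 Ω φ) (toL2 u) := by
  rw [pairing, L2.inner_def]
  refine integral_congr_ae ?_
  filter_upwards [(memLp_test Ω φ).coeFn_toLp] with x hx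
  have h : (testToL2 Ω φ) x = φ x := hx
  simp [h]

/-! ### Eigenvalues, equilibria and the linearization -/

/-- The eigenspace of `(-Δ)^m` with `m` zero Dirichlet conditions: the `u ∈ H^m_0(Ω)` with
`(-Δ)^m u = μ u` weakly in `Ω`. -/
def eigenspace {N : ℕ} (Ω : Opens (Space N)) (m : ℕ) (μ : ℝ) : Submodule ℝ (Hm0 Ω m) where
  carrier := {u | ∀ φ : 𝓓(Ω, ℝ), pairing u (polyLaplacian Ω m φ) = μ * pairing u φ}
  add_mem' {u v} hu hv φ := by
    have h1 := hu φ
    have h2 := hv φ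
    simp only [pairing_eq_inner, map_add, inner_add_right] at h1 h2 ⊢
    rw [h1, h2]; ring
  zero_mem' φ := by simp [pairing_eq_inner]
  smul_mem' c u hu φ := by
    have h1 := hu φ
    simp only [pairing_eq_inner, map_smul, inner_smul_right] at h1 ⊢
    rw [h1]; ring

/-- `μ` is an eigenvalue of `(-Δ)^m` with `m` zero Dirichlet conditions on `Ω`. -/
def IsDirichletEigenvalue {N : ℕ} (Ω : Opens (Space N)) (m : ℕ) (μ : ℝ) : Prop :=
  eigenspace Ω m μ ≠ ⊥

/-- The operator `V'(u) = -(-Δ)^m u + lam u - (∫_Ω u²) u`, as a distribution on `Ω`: the value at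
the test function `φ`. -/
def opV' {N : ℕ} {Ω : Opens (Space N)} {m : ℕ} (lam : ℝ) (u : Hm0 Ω m) (φ : 𝓓(Ω, ℝ)) : ℝ :=
  -pairing u (polyLaplacian Ω m φ) + lam * pairing u φ - integralMul u u * pairing u φ

/-- The set of equilibria: weak solutions `ψ ∈ H^m_0(Ω)` of `V'(ψ) = 0`. -/
def equilibria {N : ℕ} (Ω : Opens (Space N)) (m : ℕ) (lam : ℝ) : Set (Hm0 Ω m) :=
  {ψ | ∀ φ : 𝓓(Ω, ℝ), opV' lam ψ φ = 0}

/-- The linearization `V''(ψ)v`, as a distribution on `Ω`: the Fréchet derivative at `ψ` of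
`u ↦ V'(u)` in the direction `v`, evaluated at the test function `φ`. -/
def opV'' {N : ℕ} {Ω : Opens (Space N)} {m : ℕ} (lam : ℝ) (ψ v : Hm0 Ω m) (φ : 𝓓(Ω, ℝ)) : ℝ :=
  fderiv ℝ (fun u : Hm0 Ω m => opV' lam u φ) ψ v

/-- The kernel of `V''(ψ)` in `H^m_0(Ω)`. -/
def kerV'' {N : ℕ} {Ω : Opens (Space N)} {m : ℕ} (lam : ℝ) (ψ : Hm0 Ω m) :
    Submodule ℝ (Hm0 Ω m) where
  carrier := {v | ∀ φ : 𝓓(Ω, ℝ), opV'' lam ψ v φ = 0}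
  add_mem' {u v} hu hv φ := by
    have h1 := hu φ
    have h2 := hv φ
    simp only [opV'', map_add] at h1 h2 ⊢
    rw [h1, h2, add_zero]
  zero_mem' φ := by simp [opV'']
  smul_mem' c u hu φ := by
    have h1 := hu φ
    simp only [opV'', map_smul] at h1 ⊢
    rw [h1, smul_zero]

/-! ### Smooth submanifolds and the resonance branching hypothesis -/

/-- `S` is an embedded `C^∞` submanifold of dimension `k` of the normed space `E`: near each of its
points it is the image of an open subset of `ℝ^k` under a smooth immersion that is a homeomorphism
onto its image. -/
def IsSmoothSubmanifold {E : Type*} [NormedAddCommGroup E] [NormedSpace ℝ E]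
    (k : ℕ) (S : Set E) : Prop :=
  ∀ p ∈ S, ∃ (U : Set E) (W : Set (Space k)) (f : Space k → E) (g : E → Space k),
    IsOpen U ∧ p ∈ U ∧ IsOpen W ∧ f '' W = S ∩ U ∧
    ContDiffOn ℝ ∞ f W ∧ (∀ w ∈ W, Function.Injective (fderiv ℝ f w)) ∧
    ContinuousOn g (S ∩ U) ∧ ∀ w ∈ W, g (f w) = w

/-- Branching of equilibria occurs at `ψ`: it is an equilibrium which is not isolated in the set of
all equilibria. -/
def BranchingAt {N : ℕ} {Ω : Opens (Space N)} {m : ℕ} (lam : ℝ) (ψ : Hm0 Ω m) : Prop :=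
  ψ ∈ equilibria Ω m lam ∧ AccPt ψ (𝓟 (equilibria Ω m lam))

/-- The resonance branching hypothesis: wherever branching occurs at an equilibrium `ψ` with
`dim ker V''(ψ) = k ≥ 1`, the set of equilibria near `ψ` is a smooth `k`-dimensional manifold. -/
def ResonanceHypothesis {N : ℕ} (Ω : Opens (Space N)) (m : ℕ) (lam : ℝ) : Prop :=
  ∀ ψ : Hm0 Ω m, BranchingAt lam ψ →
    ∀ k : ℕ, 1 ≤ k → Module.finrank ℝ (kerV'' lam ψ) = k →
      ∃ U : Set (Hm0 Ω m), IsOpen U ∧ ψ ∈ U ∧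
        IsSmoothSubmanifold k (equilibria Ω m lam ∩ U)

end NonlocalResonance

end

/-! For fixed ψ the nonlocal coefficient ∫ψ² is a number, so V'(ψ) = 0 says exactly that ψ solves
the linear equation (-Δ)^m ψ = (λ_l - ‖ψ‖²)ψ (`mem_equilibria_iff`). Hence the equilibria are 0 and,
for each eigenvalue μ < λ_l, the L²-sphere of radius √(λ_l - μ) in E_μ. Distinct eigenspaces are
L²-orthogonal, so an equilibrium at L²-distance less than √(λ_l - μ) from a point of such a sphere
lies on that sphere (`mem_equilibria_iff_of_close`).

At ψ ≠ 0, testing the linearized equation with ψ itself gives ∫ψv = 0, so the kernel is the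
orthogonal complement of ψ in E_μ, the tangent space of the sphere
(`mem_kerV''_iff_of_mem_equilibria`); the dimensions therefore agree. At ψ = 0 the kernel is
E_{λ_l}, but no branching occurs: only finitely many eigenvalues lie below λ_l, so the radii stay
away from 0.

That finiteness, and the finite dimension of eigenspaces, come from a counting bound
(`exists_card_le_of_energy_le`). For L²-orthonormal u_i of energy at most Λ, Bessel's inequality
against plane waves cut off to the bounded set Ω bounds ∑|û_i(ξ)|² at each ξ, uniformly in their
number, while the energy makes the mass at high frequencies small. Integrating over a ball of
frequencies bounds the number of u_i. -/

noncomputable section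

namespace NonlocalResonance

open scoped SchwartzMap FourierTransform
open LineDeriv

variable {N : ℕ} {Ω : Opens (Space N)} {m : ℕ}

/-! ### Test functions as Schwartz functions -/

/-- A real test function as a complex-valued Schwartz function. -/
def toSchwartz (φ : 𝓓(Ω, ℝ)) : 𝓢(Space N, ℂ) :=
  HasCompactSupport.toSchwartzMap (f := fun x => (φ x : ℂ))
    (φ.hasCompactSupport.comp_left (g := ((↑) : ℝ → ℂ)) Complex.ofReal_zero)
    (Complex.ofRealCLM.contDiff.comp φ.contDiff)

@[simp]
theorem toSchwartz_apply (φ : 𝓓(Ω, ℝ)) (x : Space N) : toSchwartz φ x = φ x := rfl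

theorem lineDerivOp_test_apply (v : Space N) (φ : 𝓓(Ω, ℝ)) (x : Space N) :
    (∂_{v} φ : 𝓓(Ω, ℝ)) x = fderiv ℝ φ x v := by
  rw [TestFunction.lineDerivOp_eq_lineDerivCLM ℝ, TestFunction.lineDerivCLM_apply_of_le (by simp)]
  exact ((φ.contDiff.differentiable (by simp)).differentiableAt).lineDeriv_eq_fderiv

theorem toSchwartz_lineDerivOp (v : Space N) (φ : 𝓓(Ω, ℝ)) :
    toSchwartz (∂_{v} φ) = ∂_{v} (toSchwartz φ) := by
  ext x
  rw [SchwartzMap.lineDerivOp_apply_eq_fderiv, toSchwartz_apply, lineDerivOp_test_apply]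
  have h : HasFDerivAt φ (fderiv ℝ φ x) x :=
    ((φ.contDiff.differentiable (by simp)).differentiableAt).hasFDerivAt
  have h2 : HasFDerivAt (toSchwartz φ) (Complex.ofRealCLM.comp (fderiv ℝ φ x)) x :=
    Complex.ofRealCLM.hasFDerivAt.comp x h
  rw [h2.fderiv]
  rfl

theorem toSchwartz_iteratedLineDerivOp {r : ℕ} (w : Fin r → Space N) (φ : 𝓓(Ω, ℝ)) :
    toSchwartz (∂^{w} φ) = ∂^{w} (toSchwartz φ) := by
  induction r with
  | zero => rfl
  | succ r ih => rw [iteratedLineDerivOp_succ_left, iteratedLineDerivOp_succ_left,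
      toSchwartz_lineDerivOp, ih]

theorem lineDerivOp_test_comm (v w : Space N) (φ : 𝓓(Ω, ℝ)) :
    ∂_{v} (∂_{w} φ) = ∂_{w} (∂_{v} φ) := by
  have key : ∀ (v w x : Space N), (∂_{v} (∂_{w} φ) : 𝓓(Ω, ℝ)) x
      = fderiv ℝ (fderiv ℝ φ) x v w := by
    intro v w x
    rw [lineDerivOp_test_apply]
    have h1 : (∂_{w} φ : 𝓓(Ω, ℝ)) = fun y => fderiv ℝ φ y w :=
      funext fun y => lineDerivOp_test_apply w φ y
    have hd : DifferentiableAt ℝ (fderiv ℝ φ) x :=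
      ((φ.contDiff.fderiv_right (m := 1) (by norm_cast)).differentiable (by simp)).differentiableAt
    rw [h1, fderiv_clm_apply hd (by fun_prop)]
    simp
  ext x
  rw [key, key]
  exact (φ.contDiff.contDiffAt.isSymmSndFDerivAt (by
    simpa using WithTop.coe_le_coe.2 (le_top : (2 : ℕ∞) ≤ ⊤))).eq v w

theorem iteratedLineDerivOp_test_comm {r : ℕ} (w : Fin r → Space N) (v : Space N)
    (φ : 𝓓(Ω, ℝ)) : ∂^{w} (∂_{v} φ) = ∂_{v} (∂^{w} φ) := by
  induction r with
  | zero => rfl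
  | succ r ih => rw [iteratedLineDerivOp_succ_left, iteratedLineDerivOp_succ_left, ih,
      lineDerivOp_test_comm]

theorem support_test_subset (φ : 𝓓(Ω, ℝ)) : Function.support φ ⊆ (Ω : Set (Space N)) :=
  (subset_tsupport _).trans φ.tsupport_subset

theorem testToL2_coeFn (φ : 𝓓(Ω, ℝ)) :
    testToL2 Ω φ =ᵐ[volume.restrict (Ω : Set (Space N))] φ := (memLp_test Ω φ).coeFn_toLp

theorem inner_testToL2 (φ χ : 𝓓(Ω, ℝ)) :
    inner ℝ (testToL2 Ω φ) (testToL2 Ω χ) = ∫ x, φ x * χ x := by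
  rw [L2.inner_def, ← setIntegral_eq_integral_of_forall_compl_eq_zero
    (s := (Ω : Set (Space N))) (f := fun x => φ x * χ x)]
  · refine integral_congr_ae ?_
    filter_upwards [testToL2_coeFn φ, testToL2_coeFn χ] with x h1 h2
    simp [h1, h2, mul_comm]
  · intro x hx
    have : φ x = 0 := by
      by_contra h
      exact hx (support_test_subset φ h)
    simp [this]

theorem norm_testToL2_sq (φ : 𝓓(Ω, ℝ)) :
    ‖testToL2 Ω φ‖ ^ 2 = ∫ x, ‖toSchwartz φ x‖ ^ 2 := by
  rw [← real_inner_self_eq_norm_sq, inner_testToL2]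
  simp [sq]

theorem inner_testToL2_lineDerivOp (v : Space N) (φ χ : 𝓓(Ω, ℝ)) :
    inner ℝ (testToL2 Ω φ) (testToL2 Ω (∂_{v} χ)) =
      -inner ℝ (testToL2 Ω (∂_{v} φ)) (testToL2 Ω χ) := by
  rw [inner_testToL2, inner_testToL2]
  have h := SchwartzMap.integral_mul_lineDerivOp_right_eq_neg_left (μ := volume)
    (toSchwartz φ) (toSchwartz χ) v
  rw [← toSchwartz_lineDerivOp, ← toSchwartz_lineDerivOp] at h
  simp only [toSchwartz_apply, ← Complex.ofReal_mul] at h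
  rw [integral_complex_ofReal, integral_complex_ofReal] at h
  exact_mod_cast h

theorem inner_testToL2_testLaplacian (φ χ : 𝓓(Ω, ℝ)) :
    inner ℝ (testToL2 Ω φ) (testToL2 Ω ((-testLaplacian Ω) χ)) =
      ∑ i : Fin N, inner ℝ (testToL2 Ω (∂_{coordVec i} φ)) (testToL2 Ω (∂_{coordVec i} χ)) := by
  have h : (-testLaplacian Ω) χ = -∑ i : Fin N, ∂_{coordVec i} (∂_{coordVec i} χ) := rfl
  rw [h, map_neg, map_sum, inner_neg_right, inner_sum, ← Finset.sum_neg_distrib]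
  exact Finset.sum_congr rfl fun i _ => by rw [inner_testToL2_lineDerivOp, neg_neg]

theorem testLaplacian_lineDerivOp_comm (v : Space N) (φ : 𝓓(Ω, ℝ)) :
    (-testLaplacian Ω) (∂_{v} φ) = ∂_{v} ((-testLaplacian Ω) φ) := by
  have h : ∀ χ : 𝓓(Ω, ℝ), (-testLaplacian Ω) χ =
    -∑ i : Fin N, ∂_{coordVec i} (∂_{coordVec i} χ) := fun χ => rfl
  rw [h, h, lineDerivOp_neg, lineDerivOp_sum]
  congr 1
  refine Finset.sum_congr rfl fun i _ => ?_
  rw [lineDerivOp_test_comm (coordVec i) v φ, lineDerivOp_test_comm (coordVec i) v]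

theorem polyLaplacian_lineDerivOp_comm (m : ℕ) (v : Space N) (φ : 𝓓(Ω, ℝ)) :
    polyLaplacian Ω m (∂_{v} φ) = ∂_{v} (polyLaplacian Ω m φ) := by
  induction m with
  | zero => rfl
  | succ m ih =>
    have h : ∀ χ : 𝓓(Ω, ℝ), polyLaplacian Ω (m + 1) χ =
        (-testLaplacian Ω) (polyLaplacian Ω m χ) := fun χ => by
      simp only [polyLaplacian, pow_succ', Module.End.mul_apply]
    rw [h, h, ih, testLaplacian_lineDerivOp_comm]

/-- The Green formula for the polyharmonic operator. -/
theorem inner_testToL2_polyLaplacian (m : ℕ) (φ χ : 𝓓(Ω, ℝ)) :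
    inner ℝ (testToL2 Ω φ) (testToL2 Ω (polyLaplacian Ω m χ)) =
      ∑ w : Fin m → Fin N, inner ℝ (testToL2 Ω (∂^{fun a => coordVec (w a)} φ))
        (testToL2 Ω (∂^{fun a => coordVec (w a)} χ)) := by
  induction m generalizing φ χ with
  | zero => simp [polyLaplacian]
  | succ m ih =>
    have h : polyLaplacian Ω (m + 1) χ = (-testLaplacian Ω) (polyLaplacian Ω m χ) := by
      simp only [polyLaplacian, pow_succ', Module.End.mul_apply]
    -- A tuple of length m + 1 is a first index i and a tail; ∂_i commutes with (-Δ)^m, so the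
    -- induction hypothesis applies to ∂_i φ and ∂_i χ.
    rw [h, inner_testToL2_testLaplacian, ← (Fin.consEquiv fun _ => Fin N).sum_comp,
      Fintype.sum_prod_type]
    refine Finset.sum_congr rfl fun i _ => ?_
    rw [← polyLaplacian_lineDerivOp_comm, ih]
    refine Finset.sum_congr rfl fun w _ => ?_
    rw [iteratedLineDerivOp_succ_left, iteratedLineDerivOp_succ_left,
      iteratedLineDerivOp_test_comm, iteratedLineDerivOp_test_comm]
    rfl

theorem inner_testToL2_iteratedLineDerivOp {r : ℕ} (w : Fin r → Space N) (φ χ : 𝓓(Ω, ℝ)) :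
    inner ℝ (testToL2 Ω χ) (testToL2 Ω (∂^{w} φ)) =
      (-1) ^ r * inner ℝ (testToL2 Ω (∂^{w} χ)) (testToL2 Ω φ) := by
  induction r generalizing χ with
  | zero => simp
  | succ r ih =>
    rw [iteratedLineDerivOp_succ_left, inner_testToL2_lineDerivOp, ih,
      iteratedLineDerivOp_succ_left, iteratedLineDerivOp_test_comm, pow_succ]
    simp

/-! ### The energy form on `H^m_0(Ω)` -/

/-- A test function as an element of `H^m_0(Ω)`. -/
def testToHm0 (m : ℕ) (φ : 𝓓(Ω, ℝ)) : Hm0 Ω m :=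
  ⟨jet Ω m φ, subset_closure ⟨φ, rfl⟩⟩

@[simp]
theorem toL2_testToHm0 (φ : 𝓓(Ω, ℝ)) : toL2 (testToHm0 m φ) = testToL2 Ω φ := rfl

theorem testToHm0_apply (φ : 𝓓(Ω, ℝ)) (i : JetIndex N m) :
    (testToHm0 m φ).1 i = testToL2 Ω (∂^{fun a => coordVec (i.2 a)} φ) := rfl

/-- Continuous identities on `Hm0` need only be checked on test functions. -/
theorem denseRange_testToHm0 : DenseRange (testToHm0 (Ω := Ω) m) := by
  intro u
  rw [closure_subtype]
  have h : ((↑) : Hm0 Ω m → JetSpace Ω m) '' Set.range (testToHm0 m) =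
      (LinearMap.range (jet Ω m) : Set (JetSpace Ω m)) := by
    ext x
    simp [testToHm0]
  rw [h]
  exact u.2

/-- The bilinear form `∑_{|w| = m} ∫_Ω ∂^w u ∂^w v` on `H^m_0(Ω)`. -/
def energy (u v : Hm0 Ω m) : ℝ :=
  ∑ w : Fin m → Fin N, inner ℝ (u.1 ⟨Fin.last m, w⟩) (v.1 ⟨Fin.last m, w⟩)

theorem energy_comm (u v : Hm0 Ω m) : energy u v = energy v u :=
  Finset.sum_congr rfl fun _ _ => real_inner_comm _ _

theorem continuous_jetComponent (i : JetIndex N m) : Continuous fun u : Hm0 Ω m => u.1 i :=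
  ((PiLp.proj 2 (fun _ : JetIndex N m => L2 Ω) i).comp (Hm0 Ω m).subtypeL).continuous

theorem continuous_energy : Continuous fun p : Hm0 Ω m × Hm0 Ω m => energy p.1 p.2 := by
  unfold energy
  refine continuous_finsetSum _ fun w _ => ?_
  exact ((continuous_jetComponent _).comp continuous_fst).inner
    ((continuous_jetComponent _).comp continuous_snd)

theorem continuous_energy_left (v : Hm0 Ω m) : Continuous fun u : Hm0 Ω m => energy u v :=
  continuous_energy.comp (continuous_id.prodMk continuous_const)

theorem continuous_energy_right (u : Hm0 Ω m) : Continuous fun v : Hm0 Ω m => energy u v :=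
  continuous_energy.comp (continuous_const.prodMk continuous_id)

/-- Green's formula passes to the limit in u; the weak operator becomes a symmetric continuous form.
-/
theorem pairing_polyLaplacian (u : Hm0 Ω m) (φ : 𝓓(Ω, ℝ)) :
    pairing u (polyLaplacian Ω m φ) = energy u (testToHm0 m φ) := by
  rw [pairing_eq_inner]
  refine denseRange_testToHm0.induction_on u (isClosed_eq (by fun_prop)
    (continuous_energy_left _)) fun χ => ?_
  rw [toL2_testToHm0, real_inner_comm, inner_testToL2_polyLaplacian]
  rfl

theorem pairing_eq_inner_testToHm0 (u : Hm0 Ω m) (φ : 𝓓(Ω, ℝ)) :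
    pairing u φ = inner ℝ (toL2 u) (toL2 (testToHm0 m φ)) := by
  rw [pairing_eq_inner, real_inner_comm, toL2_testToHm0]

theorem integralMul_eq_inner (u v : Hm0 Ω m) : integralMul u v = inner ℝ (toL2 u) (toL2 v) := by
  rw [integralMul, L2.inner_def]
  refine integral_congr_ae (Eventually.of_forall fun x => ?_)
  simp only [RCLike.inner_apply, conj_trivial]
  exact mul_comm _ _

theorem integralMul_self (u : Hm0 Ω m) : integralMul u u = ‖toL2 u‖ ^ 2 := by
  rw [integralMul_eq_inner, real_inner_self_eq_norm_sq]

/-- By density the equation may be tested with any element of `Hm0`, in particular with other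
eigenfunctions. -/
theorem mem_eigenspace_iff {μ : ℝ} {u : Hm0 Ω m} :
    u ∈ eigenspace Ω m μ ↔ ∀ v, energy u v = μ * inner ℝ (toL2 u) (toL2 v) := by
  have h : u ∈ eigenspace Ω m μ ↔
      ∀ φ : 𝓓(Ω, ℝ), pairing u (polyLaplacian Ω m φ) = μ * pairing u φ := Iff.rfl
  simp only [h, pairing_polyLaplacian]
  simp only [pairing_eq_inner_testToHm0]
  refine ⟨fun H v => ?_, fun H φ => H _⟩
  exact denseRange_testToHm0.induction_on v (isClosed_eq (continuous_energy_right u)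
    (by fun_prop)) H

theorem inner_toL2_eq_zero_of_mem_eigenspace {μ ν : ℝ} {u v : Hm0 Ω m}
    (hu : u ∈ eigenspace Ω m μ) (hv : v ∈ eigenspace Ω m ν) (h : μ ≠ ν) :
    inner ℝ (toL2 u) (toL2 v) = 0 := by
  have h1 := mem_eigenspace_iff.1 hu v
  have h2 := mem_eigenspace_iff.1 hv u
  rw [energy_comm, h1, real_inner_comm (toL2 u)] at h2
  have h3 : (μ - ν) * inner ℝ (toL2 u) (toL2 v) = 0 := by linarith
  exact (mul_eq_zero.1 h3).resolve_left (sub_ne_zero.2 h)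

/-- The recorded components are weak derivatives: integration by parts survives the limit from test
functions. -/
theorem inner_testToL2_jetComponent (u : Hm0 Ω m) (i : JetIndex N m) (χ : 𝓓(Ω, ℝ)) :
    inner ℝ (testToL2 Ω χ) (u.1 i) = (-1) ^ (i.1 : ℕ) *
      inner ℝ (testToL2 Ω (∂^{fun a => coordVec (i.2 a)} χ)) (toL2 u) := by
  refine denseRange_testToHm0.induction_on u (isClosed_eq
    (continuous_const.inner (continuous_jetComponent i)) (by fun_prop)) fun φ => ?_
  rw [testToHm0_apply, inner_testToL2_iteratedLineDerivOp, toL2_testToHm0]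

theorem eq_zero_of_inner_testToL2_eq_zero {f : L2 Ω}
    (h : ∀ χ : 𝓓(Ω, ℝ), inner ℝ (testToL2 Ω χ) f = 0) : f = 0 := by
  have hf : LocallyIntegrableOn f (Ω : Set (Space N)) volume := by
    refine locallyIntegrableOn_of_locallyIntegrable_restrict ?_
    exact (Lp.memLp f).locallyIntegrable (by norm_num)
  have key := IsOpen.ae_eq_zero_of_integral_contDiff_smul_eq_zero Ω.isOpen hf ?_
  · refine (Lp.eq_zero_iff_ae_eq_zero).2 ?_
    exact (ae_restrict_iff' Ω.isOpen.measurableSet).2 key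
  · intro g hg hgc hgs
    let χ : 𝓓(Ω, ℝ) := ⟨g, hg, hgc, hgs⟩
    have h1 := h χ
    rw [L2.inner_def] at h1
    rw [← h1, ← setIntegral_eq_integral_of_forall_compl_eq_zero (s := (Ω : Set (Space N)))
      (f := fun x => g x • f x)]
    · refine integral_congr_ae ?_
      filter_upwards [testToL2_coeFn χ] with x hx
      have hx' : testToL2 Ω χ x = g x := hx
      simp [hx', mul_comm]
    · intro x hx
      have : g x = 0 := image_eq_zero_of_notMem_tsupport fun h => hx (hgs h)
      simp [this]

/-- A function determines its weak derivatives. In particular a nonzero equilibrium has positive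
L²-norm. -/
theorem toL2_injective : Function.Injective (toL2 : Hm0 Ω m → L2 Ω) := by
  refine (injective_iff_map_eq_zero _).2 fun u hu => ?_
  ext1
  ext1 i
  refine eq_zero_of_inner_testToL2_eq_zero fun χ => ?_
  rw [inner_testToL2_jetComponent, hu, inner_zero_right, mul_zero]

/-! ### Equilibria and the linearization -/

theorem hasFDerivAt_opV' (lam : ℝ) (ψ : Hm0 Ω m) (φ : 𝓓(Ω, ℝ)) :
    ∃ D : Hm0 Ω m →L[ℝ] ℝ, HasFDerivAt (fun u : Hm0 Ω m => opV' lam u φ) D ψ ∧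
      ∀ v, D v = -pairing v (polyLaplacian Ω m φ) + lam * pairing v φ
        - 2 * pairing ψ φ * integralMul ψ v - pairing v φ * integralMul ψ ψ := by
  let P : 𝓓(Ω, ℝ) → Hm0 Ω m →L[ℝ] ℝ := fun χ => (innerSL ℝ (testToL2 Ω χ)).comp toL2
  have hP : ∀ χ (u : Hm0 Ω m), pairing u χ = P χ u := fun χ u => pairing_eq_inner u χ
  have hT : HasFDerivAt (fun u : Hm0 Ω m => toL2 u) toL2 ψ :=
    (toL2 : Hm0 Ω m →L[ℝ] L2 Ω).hasFDerivAt
  have hI := hT.inner ℝ hT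
  have h := (((P (polyLaplacian Ω m φ)).hasFDerivAt (x := ψ)).neg.add
    (((P φ).hasFDerivAt (x := ψ)).const_mul lam)).sub (hI.mul ((P φ).hasFDerivAt (x := ψ)))
  refine ⟨_, h.congr_of_eventuallyEq (Eventually.of_forall fun u => ?_), fun v => ?_⟩
  · simp [opV', hP, integralMul_eq_inner]
  · simp [hP, integralMul_eq_inner, real_inner_comm (toL2 ψ) (toL2 v)]
    ring

theorem opV''_apply (lam : ℝ) (ψ v : Hm0 Ω m) (φ : 𝓓(Ω, ℝ)) :
    opV'' lam ψ v φ = -pairing v (polyLaplacian Ω m φ) + lam * pairing v φ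
        - 2 * pairing ψ φ * integralMul ψ v - pairing v φ * integralMul ψ ψ := by
  obtain ⟨D, hD, h⟩ := hasFDerivAt_opV' lam ψ φ
  rw [opV'', hD.fderiv, h]

theorem mem_equilibria_iff {lam : ℝ} {ψ : Hm0 Ω m} :
    ψ ∈ equilibria Ω m lam ↔ ψ ∈ eigenspace Ω m (lam - ‖toL2 ψ‖ ^ 2) := by
  refine forall_congr' fun φ => ?_
  rw [opV', integralMul_self]
  constructor <;> intro h <;> linarith

theorem mem_kerV''_iff {lam : ℝ} {ψ v : Hm0 Ω m} :
    v ∈ kerV'' lam ψ ↔ ∀ w, energy v w = (lam - ‖toL2 ψ‖ ^ 2) * inner ℝ (toL2 v) (toL2 w)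
      - 2 * inner ℝ (toL2 ψ) (toL2 v) * inner ℝ (toL2 ψ) (toL2 w) := by
  have h : v ∈ kerV'' lam ψ ↔ ∀ φ : 𝓓(Ω, ℝ), opV'' lam ψ v φ = 0 := Iff.rfl
  simp only [h, opV''_apply, pairing_polyLaplacian, integralMul_self]
  simp only [pairing_eq_inner_testToHm0, integralMul_eq_inner]
  refine ⟨fun H w => ?_, fun H φ => by rw [H]; ring⟩
  refine denseRange_testToHm0.induction_on w (isClosed_eq (continuous_energy_right v)
    (by fun_prop)) fun φ => ?_
  linarith [H φ]

theorem kerV''_zero (lam : ℝ) : kerV'' lam (0 : Hm0 Ω m) = eigenspace Ω m lam := by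
  ext v
  rw [mem_kerV''_iff, mem_eigenspace_iff]
  simp

/-- Test the linearized equation with ψ and the equation of ψ with v. By symmetry of the energy what
remains is 2⟨ψ, v⟩‖ψ‖² = 0, so the rank-one nonlocal term vanishes. -/
theorem mem_kerV''_iff_of_mem_equilibria {lam : ℝ} {ψ v : Hm0 Ω m} (hψ : ψ ∈ equilibria Ω m lam)
    (h0 : ψ ≠ 0) : v ∈ kerV'' lam ψ ↔
      v ∈ eigenspace Ω m (lam - ‖toL2 ψ‖ ^ 2) ∧ inner ℝ (toL2 ψ) (toL2 v) = 0 := by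
  rw [mem_kerV''_iff, mem_eigenspace_iff]
  constructor
  · intro H
    have h1 := H ψ
    rw [energy_comm, mem_eigenspace_iff.1 (mem_equilibria_iff.1 hψ) v,
      real_inner_self_eq_norm_sq, real_inner_comm (toL2 ψ) (toL2 v)] at h1
    have hn : ‖toL2 ψ‖ ^ 2 ≠ 0 := by
      have : toL2 ψ ≠ 0 := fun h => h0 (toL2_injective (by rw [h, map_zero]))
      positivity
    have h2 : inner ℝ (toL2 ψ) (toL2 v) = 0 := by
      have : inner ℝ (toL2 ψ) (toL2 v) * ‖toL2 ψ‖ ^ 2 = 0 := by linarith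
      exact (mul_eq_zero.1 this).resolve_right hn
    exact ⟨fun w => by rw [H, h2]; ring, h2⟩
  · rintro ⟨H, h2⟩ w
    rw [H, h2]; ring

/-- Two eigenfunctions that are `L²`-close belong to the same eigenvalue. -/
theorem eigenvalue_eq_of_norm_sub_lt {μ ν : ℝ} {u v : Hm0 Ω m} (hu : u ∈ eigenspace Ω m μ)
    (hv : v ∈ eigenspace Ω m ν) (h : ‖toL2 v - toL2 u‖ < ‖toL2 u‖) : ν = μ := by
  by_contra hne
  -- Orthogonality would give ‖v - u‖² = ‖v‖² + ‖u‖² ≥ ‖u‖².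
  have h1 := inner_toL2_eq_zero_of_mem_eigenspace hv hu hne
  have h2 := norm_sub_sq_real (toL2 v) (toL2 u)
  rw [h1] at h2
  nlinarith [norm_nonneg (toL2 v - toL2 u), norm_nonneg (toL2 u), sq_nonneg ‖toL2 v‖]

/-! ### Counting eigenfunctions by the Fourier transform -/

theorem norm_sq_fourier_iteratedLineDerivOp {r : ℕ} (w : Fin r → Fin N) (f : 𝓢(Space N, ℂ))
    (ξ : Space N) : ‖𝓕 (∂^{fun a => coordVec (w a)} f) ξ‖ ^ 2 =
      (∏ a, (2 * Real.pi * ξ (w a)) ^ 2) * ‖𝓕 f ξ‖ ^ 2 := by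
  induction r with
  | zero => simp
  | succ r ih =>
    have hg : (fun x : Space N => inner ℝ x (coordVec (w 0))).HasTemperateGrowth := by fun_prop
    rw [iteratedLineDerivOp_succ_left, SchwartzMap.fourier_lineDerivOp_eq, smul_apply,
      SchwartzMap.smulLeftCLM_apply_apply hg, norm_smul, norm_smul, mul_pow, mul_pow,
      Fin.prod_univ_succ]
    have h := ih (Fin.tail w)
    have ht : Fin.tail (fun a => (coordVec (w a) : Space N)) =
      fun a => coordVec (Fin.tail w a) := rfl
    rw [ht, h]
    have h1 : inner ℝ ξ (coordVec (w 0)) = ξ (w 0) := by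
      simp [coordVec, EuclideanSpace.inner_single_right]
    have h2 : ‖(2 * Real.pi * Complex.I : ℂ)‖ = 2 * Real.pi := by
      simp [abs_of_pos Real.pi_pos]
    rw [h1, h2, Real.norm_eq_abs, sq_abs]
    simp only [Fin.tail]
    ring

/-- Expanding (∑ ξ_i²)^m gives one product per tuple w; summing over tuples rather than
multi-indices supplies the multinomial weights. -/
theorem sum_norm_sq_fourier_iteratedLineDerivOp (m : ℕ) (f : 𝓢(Space N, ℂ)) (ξ : Space N) :
    ∑ w : Fin m → Fin N, ‖𝓕 (∂^{fun a => coordVec (w a)} f) ξ‖ ^ 2 =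
      ((2 * Real.pi * ‖ξ‖) ^ 2) ^ m * ‖𝓕 f ξ‖ ^ 2 := by
  simp only [norm_sq_fourier_iteratedLineDerivOp]
  rw [← Finset.sum_mul, ← Fintype.sum_pow (fun i => (2 * Real.pi * ξ i) ^ 2), mul_pow,
    EuclideanSpace.norm_sq_eq, Finset.mul_sum]
  simp [mul_pow]

theorem integrable_norm_sq_schwartz (f : 𝓢(Space N, ℂ)) : Integrable fun x => ‖f x‖ ^ 2 :=
  (f.memLp 2).integrable_norm_pow (by norm_num)

theorem energy_testToHm0 (φ : 𝓓(Ω, ℝ)) :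
    energy (testToHm0 m φ) (testToHm0 m φ) =
      ∫ ξ, ((2 * Real.pi * ‖ξ‖) ^ 2) ^ m * ‖𝓕 (toSchwartz φ) ξ‖ ^ 2 := by
  simp only [← sum_norm_sq_fourier_iteratedLineDerivOp]
  rw [integral_finsetSum _ fun w _ => integrable_norm_sq_schwartz _]
  refine Finset.sum_congr rfl fun w _ => ?_
  rw [SchwartzMap.integral_norm_sq_fourier, ← toSchwartz_iteratedLineDerivOp, ← norm_testToL2_sq,
    real_inner_self_eq_norm_sq]
  rfl

/-- The `L²`-norm is controlled by the low frequencies and the energy. -/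
theorem norm_testToL2_sq_le {R : ℝ} (hR : 0 < R) (m : ℕ) (φ : 𝓓(Ω, ℝ)) :
    ‖testToL2 Ω φ‖ ^ 2 ≤ (∫ ξ in Metric.closedBall 0 R, ‖𝓕 (toSchwartz φ) ξ‖ ^ 2) +
      (((2 * Real.pi * R) ^ 2) ^ m)⁻¹ * energy (testToHm0 m φ) (testToHm0 m φ) := by
  have hK : 0 < ((2 * Real.pi * R) ^ 2) ^ m := by positivity
  have hi := integrable_norm_sq_schwartz (𝓕 (toSchwartz φ))
  have hj : Integrable fun ξ => ((2 * Real.pi * ‖ξ‖) ^ 2) ^ m * ‖𝓕 (toSchwartz φ) ξ‖ ^ 2 := by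
    simp only [← sum_norm_sq_fourier_iteratedLineDerivOp]
    exact integrable_finsetSum _ fun w _ => integrable_norm_sq_schwartz _
  rw [norm_testToL2_sq, ← SchwartzMap.integral_norm_sq_fourier, energy_testToHm0,
    ← integral_indicator Metric.isClosed_closedBall.measurableSet, ← integral_const_mul,
    ← integral_add (hi.indicator Metric.isClosed_closedBall.measurableSet) (hj.const_mul _)]
  refine integral_mono hi
    ((hi.indicator Metric.isClosed_closedBall.measurableSet).add (hj.const_mul _)) fun ξ => ?_
  -- Outside the ball the symbol (2π‖ξ‖)^(2m) is at least (2πR)^(2m).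
  by_cases h : ξ ∈ Metric.closedBall (0 : Space N) R
  · simp only [Set.indicator_of_mem h]
    exact le_add_of_nonneg_right (by positivity)
  · simp only [Set.indicator_of_notMem h, zero_add]
    rw [mem_closedBall_zero_iff, not_le] at h
    rw [← mul_assoc]
    refine le_mul_of_one_le_left (by positivity) ?_
    rw [inv_mul_eq_div, one_le_div hK]
    gcongr

/-- The Bessel inequality for vectors close to an orthonormal family. -/
theorem sum_inner_sq_le_of_close {ι E : Type*} [Fintype ι] [NormedAddCommGroup E]
    [InnerProductSpace ℝ E] {u v : ι → E} (hu : Orthonormal ℝ u)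
    (h : ∑ i, ‖v i - u i‖ ^ 2 ≤ 1) (g : E) : ∑ i, inner ℝ g (v i) ^ 2 ≤ 4 * ‖g‖ ^ 2 := by
  have h1 : ∑ i, inner ℝ g (u i) ^ 2 ≤ ‖g‖ ^ 2 := by
    have := hu.sum_inner_products_le (s := Finset.univ) g
    simpa [real_inner_comm] using this
  have h2 : ∑ i, inner ℝ g (v i - u i) ^ 2 ≤ ‖g‖ ^ 2 := by
    calc ∑ i, inner ℝ g (v i - u i) ^ 2 ≤ ∑ i, ‖g‖ ^ 2 * ‖v i - u i‖ ^ 2 := by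
          refine Finset.sum_le_sum fun i _ => ?_
          rw [← mul_pow, ← sq_abs]
          exact pow_le_pow_left₀ (abs_nonneg _) (abs_real_inner_le_norm _ _) 2
      _ ≤ ‖g‖ ^ 2 := by
          rw [← Finset.mul_sum]
          exact mul_le_of_le_one_right (by positivity) h
  -- The 4 is 2 + 2, from (a + b)² ≤ 2a² + 2b² with v_i = u_i + (v_i - u_i).
  calc ∑ i, inner ℝ g (v i) ^ 2
      ≤ ∑ i, (2 * inner ℝ g (u i) ^ 2 + 2 * inner ℝ g (v i - u i) ^ 2) := by
        refine Finset.sum_le_sum fun i _ => ?_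
        rw [inner_sub_right]
        nlinarith [sq_nonneg (2 * inner ℝ g (u i) - inner ℝ g (v i))]
    _ ≤ 4 * ‖g‖ ^ 2 := by
        rw [Finset.sum_add_distrib, ← Finset.mul_sum, ← Finset.mul_sum]
        linarith

theorem integrable_exp_smul_toSchwartz (φ : 𝓓(Ω, ℝ)) (ξ : Space N) :
    Integrable fun x : Space N =>
      Complex.exp (↑(-2 * Real.pi * inner ℝ x ξ) * Complex.I) • toSchwartz φ x := by
  refine Integrable.mono (toSchwartz φ).integrable (Continuous.aestronglyMeasurable ?_)
    (Eventually.of_forall fun x => ?_)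
  · have h1 : Continuous fun x : Space N => -2 * Real.pi * inner ℝ x ξ := by fun_prop
    exact (Complex.continuous_exp.comp
      ((Complex.continuous_ofReal.comp h1).mul continuous_const)).smul (toSchwartz φ).continuous
  · rw [norm_smul, Complex.norm_exp_ofReal_mul_I, one_mul]

theorem re_fourier_toSchwartz (φ : 𝓓(Ω, ℝ)) (ξ : Space N) :
    (𝓕 (toSchwartz φ) ξ).re = ∫ x, Real.cos (-2 * Real.pi * inner ℝ x ξ) * φ x := by
  rw [SchwartzMap.fourier_coe, Real.fourier_eq', ← RCLike.re_eq_complex_re,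
    ← integral_re (integrable_exp_smul_toSchwartz φ ξ)]
  refine integral_congr_ae (Eventually.of_forall fun x => ?_)
  simp only [RCLike.re_eq_complex_re, toSchwartz_apply, smul_eq_mul, Complex.re_mul_ofReal,
    Complex.exp_ofReal_mul_I_re]

theorem im_fourier_toSchwartz (φ : 𝓓(Ω, ℝ)) (ξ : Space N) :
    (𝓕 (toSchwartz φ) ξ).im = ∫ x, Real.sin (-2 * Real.pi * inner ℝ x ξ) * φ x := by
  rw [SchwartzMap.fourier_coe, Real.fourier_eq', ← RCLike.im_eq_complex_im,
    ← integral_im (integrable_exp_smul_toSchwartz φ ξ)]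
  refine integral_congr_ae (Eventually.of_forall fun x => ?_)
  simp only [RCLike.im_eq_complex_im, toSchwartz_apply, smul_eq_mul, Complex.im_mul_ofReal,
    Complex.exp_ofReal_mul_I_im]

/-- The cosine and sine of the plane wave are bounded by 1, hence lie in L²(Ω) when Ω has finite
measure; this makes Bessel's inequality available at each frequency. -/
theorem exists_fourier_eq_inner (hΩ : Bornology.IsBounded (Ω : Set (Space N))) (ξ : Space N) :
    ∃ c s : L2 Ω, ‖c‖ ^ 2 ≤ volume.real (Ω : Set (Space N)) ∧
      ‖s‖ ^ 2 ≤ volume.real (Ω : Set (Space N)) ∧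
      ∀ φ : 𝓓(Ω, ℝ), ‖𝓕 (toSchwartz φ) ξ‖ ^ 2 =
        inner ℝ c (testToL2 Ω φ) ^ 2 + inner ℝ s (testToL2 Ω φ) ^ 2 := by
  have : IsFiniteMeasure (volume.restrict (Ω : Set (Space N))) :=
    ⟨by simpa using hΩ.measure_lt_top⟩
  have key : ∀ f : Space N → ℝ, Continuous f → (∀ x, |f x| ≤ 1) →
      ∃ c : L2 Ω, ‖c‖ ^ 2 ≤ volume.real (Ω : Set (Space N)) ∧
        ∀ φ : 𝓓(Ω, ℝ), inner ℝ c (testToL2 Ω φ) = ∫ x, f x * φ x := by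
    intro f hf hb
    have hm : MemLp f 2 (volume.restrict (Ω : Set (Space N))) :=
      MemLp.of_bound hf.aestronglyMeasurable 1 (Eventually.of_forall hb)
    refine ⟨hm.toLp f, ?_, fun φ => ?_⟩
    · rw [← real_inner_self_eq_norm_sq, L2.inner_def]
      have h1 : ∫ x in (Ω : Set (Space N)), inner ℝ (hm.toLp f x) (hm.toLp f x) ≤
          ∫ x in (Ω : Set (Space N)), (1 : ℝ) := by
        refine integral_mono_ae (L2.integrable_inner _ _) (integrable_const _) ?_
        filter_upwards [hm.coeFn_toLp] with x hx
        rw [hx, real_inner_self_eq_norm_sq]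
        exact pow_le_one₀ (norm_nonneg _) (hb x)
      simpa using h1
    · rw [L2.inner_def, ← setIntegral_eq_integral_of_forall_compl_eq_zero
        (s := (Ω : Set (Space N))) (f := fun x => f x * φ x)]
      · refine integral_congr_ae ?_
        filter_upwards [testToL2_coeFn φ, hm.coeFn_toLp] with x h1 h2
        simp [h1, h2, mul_comm]
      · intro x hx
        have : φ x = 0 := by
          by_contra h
          exact hx (support_test_subset φ h)
        simp [this]
  obtain ⟨c, hc, hc'⟩ := key (fun x => Real.cos (-2 * Real.pi * inner ℝ x ξ)) (by fun_prop)
    fun x => Real.abs_cos_le_one _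
  obtain ⟨s, hs, hs'⟩ := key (fun x => Real.sin (-2 * Real.pi * inner ℝ x ξ)) (by fun_prop)
    fun x => Real.abs_sin_le_one _
  refine ⟨c, s, hc, hs, fun φ => ?_⟩
  rw [Complex.sq_norm, Complex.normSq_apply, re_fourier_toSchwartz, im_fourier_toSchwartz, hc', hs']
  ring

/-- The number of `L²`-orthonormal functions in `H^m_0(Ω)` of bounded energy is bounded. -/
theorem exists_card_le_of_energy_le (hΩ : Bornology.IsBounded (Ω : Set (Space N))) (hm : 1 ≤ m)
    (Λ : ℝ) : ∃ M : ℕ, ∀ (n : ℕ) (u : Fin n → Hm0 Ω m), Orthonormal ℝ (fun i => toL2 (u i)) →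
      (∀ i, energy (u i) (u i) ≤ Λ) → n ≤ M := by
  -- With this R, a function of energy below Λ + 1 has at most 1/8 of squared L²-norm beyond
  -- frequency R. The constant C is 4|Ω| for the cosine plus 4|Ω| for the sine, and M solves n/4 ≤
  -- |B|C + n/8 for n.
  set R : ℝ := 8 * (|Λ| + 1) with hRdef
  have hR1 : 1 ≤ R := by linarith [abs_nonneg Λ]
  have hR : 0 < R := by linarith
  set B := Metric.closedBall (0 : Space N) R with hB
  set C : ℝ := 8 * volume.real (Ω : Set (Space N)) with hC
  obtain ⟨M, hM⟩ := exists_nat_ge (8 * (volume.real B * C))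
  refine ⟨M, fun n u hu he => ?_⟩
  -- The Fourier estimates concern test functions, so each u_i is approximated; the squared errors
  -- add up to at most n/(n + 1) ≤ 1.
  have happ : ∀ i, ∃ φ : 𝓓(Ω, ℝ), ‖testToL2 Ω φ - toL2 (u i)‖ ^ 2 < 1 / (n + 1) ∧
      1 / 4 < ‖testToL2 Ω φ‖ ^ 2 ∧ energy (testToHm0 m φ) (testToHm0 m φ) < Λ + 1 := by
    intro i
    let O : Set (Hm0 Ω m) := {v | ‖toL2 v - toL2 (u i)‖ ^ 2 < 1 / ((n : ℝ) + 1)} ∩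
      ({v | 1 / 4 < ‖toL2 v‖ ^ 2} ∩ {v | energy v v < Λ + 1})
    have hO : IsOpen O := by
      refine IsOpen.inter (isOpen_lt (by fun_prop) continuous_const) (IsOpen.inter
        (isOpen_lt continuous_const (by fun_prop)) (isOpen_lt ?_ continuous_const))
      exact continuous_energy.comp (continuous_id.prodMk continuous_id)
    have hui : u i ∈ O := by
      have h1 : ‖toL2 (u i)‖ = 1 := hu.1 i
      refine ⟨?_, ?_, ?_⟩
      · simp only [Set.mem_ofPred_eq, sub_self, norm_zero]
        rw [zero_pow two_ne_zero]
        positivity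
      · simp only [Set.mem_ofPred_eq, h1]
        norm_num
      · exact lt_of_le_of_lt (he i) (by linarith)
    obtain ⟨φ, h1, h2, h3⟩ := denseRange_testToHm0.exists_mem_open hO ⟨u i, hui⟩
    exact ⟨φ, h1, h2, h3⟩
  choose φ h1 h2 h3 using happ
  have hclose : ∑ i, ‖testToL2 Ω (φ i) - toL2 (u i)‖ ^ 2 ≤ 1 := by
    calc ∑ i, ‖testToL2 Ω (φ i) - toL2 (u i)‖ ^ 2 ≤ ∑ _i : Fin n, 1 / ((n : ℝ) + 1) :=
          Finset.sum_le_sum fun i _ => (h1 i).le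
      _ ≤ 1 := by
          rw [Finset.sum_const, Finset.card_univ, Fintype.card_fin, nsmul_eq_mul, mul_one_div,
            div_le_one (by positivity)]
          linarith
  have hpt : ∀ ξ, ∑ i, ‖𝓕 (toSchwartz (φ i)) ξ‖ ^ 2 ≤ C := by
    intro ξ
    obtain ⟨c, s, hc, hs, hcs⟩ := exists_fourier_eq_inner hΩ ξ
    simp only [hcs]
    rw [Finset.sum_add_distrib]
    have hc' := sum_inner_sq_le_of_close hu hclose c
    have hs' := sum_inner_sq_le_of_close hu hclose s
    linarith
  have hlow : ∑ i, ∫ ξ in B, ‖𝓕 (toSchwartz (φ i)) ξ‖ ^ 2 ≤ volume.real B * C := by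
    rw [← integral_finsetSum _ fun i _ => (integrable_norm_sq_schwartz _).integrableOn]
    have hBfin : volume B ≠ ⊤ := (isCompact_closedBall _ _).measure_lt_top.ne
    calc ∫ ξ in B, ∑ i, ‖𝓕 (toSchwartz (φ i)) ξ‖ ^ 2 ≤ ∫ _ξ in B, C := by
          refine setIntegral_mono ?_ (integrableOn_const hBfin) hpt
          exact integrable_finsetSum _ fun i _ => (integrable_norm_sq_schwartz _).integrableOn
      _ = volume.real B * C := by rw [setIntegral_const, smul_eq_mul]
  -- Here m ≥ 1 enters: for m = 0 the energy would not control high frequencies.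
  have hK : R ≤ ((2 * Real.pi * R) ^ 2) ^ m := by
    have hb : 1 * R ≤ 2 * Real.pi * R := by
      gcongr
      linarith [Real.pi_gt_three]
    have hb2 : R ≤ (2 * Real.pi * R) ^ 2 := by nlinarith
    exact hb2.trans (le_self_pow₀ (hR1.trans hb2) (by omega))
  have hsum : (n : ℝ) / 4 ≤ volume.real B * C + n / 8 := by
    calc (n : ℝ) / 4 = ∑ _i : Fin n, (1 / 4 : ℝ) := by simp; ring
      _ ≤ ∑ i, ((∫ ξ in B, ‖𝓕 (toSchwartz (φ i)) ξ‖ ^ 2) + 1 / 8) := by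
          refine Finset.sum_le_sum fun i _ => (h2 i).le.trans ?_
          refine (norm_testToL2_sq_le hR m (φ i)).trans ?_
          gcongr
          have hΛ : energy (testToHm0 m (φ i)) (testToHm0 m (φ i)) ≤ R / 8 :=
            (h3 i).le.trans (by linarith [le_abs_self Λ])
          calc _ ≤ R⁻¹ * (R / 8) := by
                refine mul_le_mul (inv_anti₀ hR hK) hΛ ?_ (by positivity)
                exact Finset.sum_nonneg fun w _ => real_inner_self_nonneg
            _ = 1 / 8 := by field_simp
      _ ≤ volume.real B * C + n / 8 := by
          rw [Finset.sum_add_distrib]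
          simp only [Finset.sum_const, Finset.card_univ, Fintype.card_fin, nsmul_eq_mul]
          linarith
  have : (n : ℝ) ≤ M := by linarith
  exact_mod_cast this

/-! ### Discreteness of the spectrum -/

/-- The `L²`-functions underlying the elements of an eigenspace. -/
def eigenspaceL2 (Ω : Opens (Space N)) (m : ℕ) (μ : ℝ) : Submodule ℝ (L2 Ω) :=
  (eigenspace Ω m μ).map (toL2 : Hm0 Ω m →L[ℝ] L2 Ω).toLinearMap

/-- An eigenspace is isomorphic to the space of the underlying `L²`-functions. -/
def eigenspaceEquivL2 (Ω : Opens (Space N)) (m : ℕ) (μ : ℝ) :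
    eigenspace Ω m μ ≃ₗ[ℝ] eigenspaceL2 Ω m μ :=
  Submodule.equivMapOfInjective _ toL2_injective _

theorem toL2_eigenspaceEquivL2_symm {μ : ℝ} (f : eigenspaceL2 Ω m μ) :
    toL2 ((eigenspaceEquivL2 Ω m μ).symm f : Hm0 Ω m) = f := by
  conv_rhs => rw [← (eigenspaceEquivL2 Ω m μ).apply_symm_apply f]
  rfl

theorem energy_self_of_mem_eigenspace {μ : ℝ} {u : Hm0 Ω m} (hu : u ∈ eigenspace Ω m μ) :
    energy u u = μ * ‖toL2 u‖ ^ 2 := by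
  rw [mem_eigenspace_iff.1 hu, real_inner_self_eq_norm_sq]

/-- L²-normalized eigenfunctions for μ have energy exactly μ, so the counting bound limits every
orthonormal family. Passing to `eigenspaceL2` provides the L² inner product. -/
theorem finiteDimensional_eigenspace (hΩ : Bornology.IsBounded (Ω : Set (Space N))) (hm : 1 ≤ m)
    (μ : ℝ) : FiniteDimensional ℝ (eigenspace Ω m μ) := by
  obtain ⟨M, hM⟩ := exists_card_le_of_energy_le (Ω := Ω) (m := m) hΩ hm μ
  have h : Module.rank ℝ (eigenspaceL2 Ω m μ) ≤ M := by
    refine rank_le fun s hs => ?_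
    let b := stdOrthonormalBasis ℝ (Submodule.span ℝ (s : Set (eigenspaceL2 Ω m μ)))
    rw [← finrank_span_finset_eq_card hs]
    have ho : Orthonormal ℝ fun i => ((b i : eigenspaceL2 Ω m μ) : L2 Ω) :=
      (b.orthonormal.comp_linearIsometry (Submodule.subtypeₗᵢ _)).comp_linearIsometry
        (Submodule.subtypeₗᵢ _)
    have ht : ∀ i, toL2 ((eigenspaceEquivL2 Ω m μ).symm (b i) : Hm0 Ω m) =
        ((b i : eigenspaceL2 Ω m μ) : L2 Ω) := fun i => toL2_eigenspaceEquivL2_symm _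
    refine hM _ (fun i => ((eigenspaceEquivL2 Ω m μ).symm (b i) : Hm0 Ω m)) ?_ fun i => ?_
    · simpa only [ht] using ho
    · rw [energy_self_of_mem_eigenspace (Submodule.coe_mem _), ht, ho.1 i]
      simp
  have : FiniteDimensional ℝ (eigenspaceL2 Ω m μ) :=
    Module.rank_lt_aleph0_iff.1 (h.trans_lt (Cardinal.natCast_lt_aleph0))
  exact LinearEquiv.finiteDimensional (eigenspaceEquivL2 Ω m μ).symm

/-- A finite-dimensional eigenspace has a basis that is orthonormal in `L²`. -/
theorem exists_orthonormal_eigenspace {μ : ℝ} {d : ℕ} [FiniteDimensional ℝ (eigenspace Ω m μ)]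
    (hd : Module.finrank ℝ (eigenspace Ω m μ) = d) :
    ∃ e : Fin d → Hm0 Ω m, (∀ i, e i ∈ eigenspace Ω m μ) ∧
      Orthonormal ℝ fun i => toL2 (e i) := by
  have : FiniteDimensional ℝ (eigenspaceL2 Ω m μ) :=
    LinearEquiv.finiteDimensional (eigenspaceEquivL2 Ω m μ)
  let b := (stdOrthonormalBasis ℝ (eigenspaceL2 Ω m μ)).reindex
    (finCongr ((eigenspaceEquivL2 Ω m μ).finrank_eq.symm.trans hd))
  refine ⟨fun i => (eigenspaceEquivL2 Ω m μ).symm (b i), fun i => Submodule.coe_mem _, ?_⟩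
  simp only [toL2_eigenspaceEquivL2_symm]
  exact b.orthonormal.comp_linearIsometry (Submodule.subtypeₗᵢ _)

/-- Unit eigenfunctions for distinct eigenvalues form an orthonormal family to which the counting
bound applies. -/
theorem finite_eigenvalues_le (hΩ : Bornology.IsBounded (Ω : Set (Space N))) (hm : 1 ≤ m)
    (Λ : ℝ) : {μ | IsDirichletEigenvalue Ω m μ ∧ μ ≤ Λ}.Finite := by
  obtain ⟨M, hM⟩ := exists_card_le_of_energy_le (Ω := Ω) (m := m) hΩ hm Λ
  by_contra hinf
  obtain ⟨t, hts, htc⟩ := Set.Infinite.exists_subset_card_eq hinf (M + 1)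
  have hex : ∀ μ : t, ∃ u ∈ eigenspace Ω m (μ : ℝ), ‖toL2 u‖ = 1 := by
    intro μ
    obtain ⟨u, hu, h0⟩ := Submodule.exists_mem_ne_zero_of_ne_bot (hts μ.2).1
    have hn : ‖toL2 u‖ ≠ 0 := by
      rw [norm_ne_zero_iff]
      exact fun h => h0 (toL2_injective (by rw [h, map_zero]))
    refine ⟨‖toL2 u‖⁻¹ • u, Submodule.smul_mem _ _ hu, ?_⟩
    rw [map_smul, norm_smul, norm_inv, norm_norm, inv_mul_cancel₀ hn]
  choose u hu hn using hex
  let σ := t.equivFinOfCardEq htc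
  have h := hM (M + 1) (fun i => u (σ.symm i)) ⟨fun i => hn _, fun i j hij => ?_⟩ fun i => ?_
  · omega
  · refine inner_toL2_eq_zero_of_mem_eigenspace (hu _) (hu _) fun h => hij ?_
    exact σ.symm.injective (Subtype.ext h)
  · rw [energy_self_of_mem_eigenspace (hu _), hn]
    simpa using (hts (σ.symm i).2).2

/-- The trivial equilibrium is isolated. -/
theorem not_accPt_zero_equilibria (hΩ : Bornology.IsBounded (Ω : Set (Space N))) (hm : 1 ≤ m)
    (lam : ℝ) : ¬ AccPt (0 : Hm0 Ω m) (𝓟 (equilibria Ω m lam)) := by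
  rw [accPt_iff_frequently, not_frequently]
  -- A nonzero equilibrium near 0 would yield an eigenvalue just below `lam`. The value `lam`,
  -- possibly an eigenvalue, is removed so that the complement of the finite set is a neighbourhood
  -- of it.
  have hfin := (finite_eigenvalues_le (Ω := Ω) (m := m) hΩ hm lam).subset
    (Set.sdiff_subset (t := {lam}))
  have hcont : Tendsto (fun ψ : Hm0 Ω m => lam - ‖toL2 ψ‖ ^ 2) (𝓝 0) (𝓝 lam) := by
    have h : Continuous fun ψ : Hm0 Ω m => lam - ‖toL2 ψ‖ ^ 2 := by fun_prop
    simpa using h.tendsto 0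
  have hev := hcont.eventually (hfin.isClosed.isOpen_compl.mem_nhds (x := lam) (by simp))
  filter_upwards [hev] with ψ hψ
  rintro ⟨h0, hE⟩
  have hn : 0 < ‖toL2 ψ‖ ^ 2 := by
    have : toL2 ψ ≠ 0 := fun h => h0 (toL2_injective (by rw [h, map_zero]))
    positivity
  refine hψ ⟨⟨?_, by linarith⟩, fun h => by simp only [Set.mem_singleton_iff] at h; linarith⟩
  exact (Submodule.ne_bot_iff _).2 ⟨ψ, mem_equilibria_iff.1 hE, h0⟩

/-! ### Spheres as submanifolds -/

theorem IsSmoothSubmanifold.inter_isOpen {E : Type*} [NormedAddCommGroup E] [NormedSpace ℝ E]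
    {k : ℕ} {S O : Set E} (hS : IsSmoothSubmanifold k S) (hO : IsOpen O) :
    IsSmoothSubmanifold k (S ∩ O) := by
  rintro p ⟨hp, hpO⟩
  obtain ⟨U, W, f, g, hU, hpU, hW, hfW, hf, hinj, hg, hgf⟩ := hS p hp
  refine ⟨U, W ∩ f ⁻¹' O, f, g, hU, hpU, hf.continuousOn.isOpen_inter_preimage hW hO, ?_,
    hf.mono Set.inter_subset_left, fun w hw => hinj w hw.1,
    hg.mono (by gcongr; exact Set.inter_subset_left), fun w hw => hgf w hw.1⟩
  rw [Set.image_inter_preimage, hfW]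
  exact Set.inter_right_comm _ _ _

/-- The image of a round sphere under a linear map with a continuous left inverse is a
submanifold. -/
theorem isSmoothSubmanifold_image_sphere {E : Type*} [NormedAddCommGroup E] [NormedSpace ℝ E]
    {k : ℕ} (L : Space (k + 1) →L[ℝ] E) (A : E →L[ℝ] Space (k + 1)) (hAL : ∀ c, A (L c) = c)
    {r : ℝ} (hr : 0 < r) : IsSmoothSubmanifold k (L '' Metric.sphere 0 r) := by
  rintro _ ⟨q, hq, rfl⟩
  rw [mem_sphere_zero_iff_norm] at hq
  have hq0 : q ≠ 0 := by
    rw [← norm_pos_iff, hq]; exact hr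
  have : Fact (Module.finrank ℝ (Space (k + 1)) = k + 1) := ⟨by simp⟩
  set V : Submodule ℝ (Space (k + 1)) := (ℝ ∙ q)ᗮ with hV
  let τ : V ≃ₗᵢ[ℝ] Space k := (OrthonormalBasis.fromOrthogonalSpanSingleton k hq0).repr
  -- The open hemisphere around q is a graph over a ball in q^⊥; the height is divided by r because
  -- ‖q‖ = r.
  let s : Space k → ℝ := fun w => √(r ^ 2 - ‖w‖ ^ 2) / r
  let h : Space k → Space (k + 1) := fun w => (τ.symm w : Space (k + 1)) + s w • q
  let G : E →L[ℝ] Space k :=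
    (τ.toContinuousLinearEquiv : V →L[ℝ] Space k).comp (V.orthogonalProjectionOnto.comp A)
  have hqV : V.orthogonalProjectionOnto q = 0 :=
    Submodule.orthogonalProjectionOnto_orthogonalComplement_singleton_eq_zero q
  have hGL : ∀ w, G (L (h w)) = w := by
    intro w
    change τ (V.orthogonalProjectionOnto (A (L (h w)))) = w
    rw [hAL]
    simp only [h, map_add, map_smul, hqV, smul_zero, add_zero,
      Submodule.orthogonalProjectionOnto_mem_subspace_eq_self]
    exact τ.apply_symm_apply w
  have hqτ : ∀ v : V, inner ℝ q (v : Space (k + 1)) = 0 := fun v =>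
    Submodule.mem_orthogonal_singleton_iff_inner_right.1 v.2
  have hball : ∀ w ∈ Metric.ball (0 : Space k) r, 0 < r ^ 2 - ‖w‖ ^ 2 := by
    intro w hw
    rw [mem_ball_zero_iff] at hw
    have := norm_nonneg w
    nlinarith
  have hsmooth : ContDiffOn ℝ ∞ (fun w => L (h w)) (Metric.ball 0 r) := by
    refine L.contDiff.comp_contDiffOn (ContDiffOn.add ?_ (ContDiffOn.fun_smul ?_ contDiffOn_const))
    · exact (V.subtypeL.contDiff.comp
        (τ.symm.toContinuousLinearEquiv : Space k →L[ℝ] V).contDiff).contDiffOn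
    · refine ContDiffOn.div_const (ContDiffOn.sqrt ?_ fun w hw => (hball w hw).ne') r
      exact (contDiff_const.sub (contDiff_norm_sq ℝ)).contDiffOn
  refine ⟨{x | 0 < inner ℝ q (A x)}, Metric.ball 0 r, fun w => L (h w), G,
    isOpen_lt continuous_const (by fun_prop), ?_, Metric.isOpen_ball, ?_, hsmooth, ?_,
    G.continuous.continuousOn, fun w _ => hGL w⟩
  · change 0 < inner ℝ q (A (L q))
    rw [hAL, real_inner_self_eq_norm_sq, hq]
    positivity
  · ext x
    constructor
    · rintro ⟨w, hw, rfl⟩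
      have hs : 0 < s w := div_pos (Real.sqrt_pos.2 (hball w hw)) hr
      refine ⟨⟨h w, ?_, rfl⟩, ?_⟩
      · have hτ : ‖(τ.symm w : Space (k + 1))‖ = ‖w‖ := τ.symm.norm_map w
        rw [mem_sphere_zero_iff_norm, ← sq_eq_sq₀ (norm_nonneg _) hr.le,
          norm_add_sq_real, real_inner_smul_right, real_inner_comm, hqτ, norm_smul, hq,
          hτ, mul_pow, Real.norm_eq_abs, sq_abs, div_pow,
          Real.sq_sqrt (hball w hw).le]
        field_simp
        ring
      · change 0 < inner ℝ q (A (L (h w)))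
        rw [hAL, inner_add_right, hqτ, real_inner_smul_right, real_inner_self_eq_norm_sq, hq]
        positivity
    · rintro ⟨⟨y, hy, rfl⟩, hyq⟩
      rw [mem_sphere_zero_iff_norm] at hy
      change 0 < inner ℝ q (A (L y)) at hyq
      rw [hAL] at hyq
      set t : ℝ := inner ℝ q y / r ^ 2 with ht
      have ht0 : 0 < t := by positivity
      set v : Space (k + 1) := y - t • q with hv
      have hvV : v ∈ V := by
        rw [hV, Submodule.mem_orthogonal_singleton_iff_inner_right, hv, inner_sub_right,
          real_inner_smul_right, real_inner_self_eq_norm_sq, hq, ht]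
        field_simp
        ring
      have hyv : y = v + t • q := by rw [hv]; abel
      have hnorm : ‖v‖ ^ 2 = r ^ 2 - (t * r) ^ 2 := by
        have h1 : ‖y‖ ^ 2 = ‖v‖ ^ 2 + (t * r) ^ 2 := by
          conv_lhs => rw [hyv]
          rw [norm_add_sq_real, real_inner_smul_right, real_inner_comm, hqτ ⟨v, hvV⟩, norm_smul,
            hq, Real.norm_eq_abs, mul_pow, sq_abs]
          ring
        rw [← hy, h1, hy]; ring
      refine ⟨τ ⟨v, hvV⟩, ?_, ?_⟩
      · rw [mem_ball_zero_iff, τ.norm_map, Submodule.coe_norm]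
        refine lt_of_pow_lt_pow_left₀ 2 hr.le ?_
        change ‖v‖ ^ 2 < r ^ 2
        rw [hnorm]
        have : 0 < (t * r) ^ 2 := by positivity
        linarith
      · have hst : s (τ ⟨v, hvV⟩) = t := by
          simp only [s]
          rw [τ.norm_map, Submodule.coe_norm]
          change √(r ^ 2 - ‖v‖ ^ 2) / r = t
          rw [hnorm, sub_sub_cancel, Real.sqrt_sq (by positivity)]
          field_simp
        change L (h (τ ⟨v, hvV⟩)) = L y
        simp only [h, hst, τ.symm_apply_apply]
        rw [← hyv]
  · intro w hw
    have hd : HasFDerivAt (fun w => L (h w)) (fderiv ℝ (fun w => L (h w)) w) w :=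
      ((hsmooth.contDiffAt (Metric.isOpen_ball.mem_nhds hw)).differentiableAt
        (by simp)).hasFDerivAt
    -- Differentiating G ∘ L ∘ h = id gives the differential a left inverse.
    have h1 : HasFDerivAt (fun w => w) (G.comp (fderiv ℝ (fun w => L (h w)) w)) w := by
      have h2 := G.hasFDerivAt.comp w hd
      exact h2.congr_of_eventuallyEq (Eventually.of_forall fun w => (hGL w).symm)
    have h3 := h1.unique (hasFDerivAt_id w)
    refine Function.LeftInverse.injective (g := G) fun x => ?_
    exact congrArg (fun T : Space k →L[ℝ] Space k => T x) h3

/-! ### Equilibria in an eigenspace -/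

section Combination

variable {k : ℕ} (e : Fin (k + 1) → Hm0 Ω m)

/-- The map `c ↦ ∑ᵢ cᵢ eᵢ`. -/
def combination : Space (k + 1) →L[ℝ] Hm0 Ω m :=
  ∑ i, (EuclideanSpace.proj i : Space (k + 1) →L[ℝ] ℝ).smulRight (e i)

theorem combination_apply (c : Space (k + 1)) : combination e c = ∑ i, c i • e i := by
  simp [combination]

/-- The coefficients `∫_Ω eᵢ u`. -/
def coefficients : Hm0 Ω m →L[ℝ] Space (k + 1) :=
  (EuclideanSpace.equiv (Fin (k + 1)) ℝ).symm.toContinuousLinearMap.comp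
    (ContinuousLinearMap.pi fun i => (innerSL ℝ (toL2 (e i))).comp toL2)

theorem coefficients_apply (u : Hm0 Ω m) (i : Fin (k + 1)) :
    coefficients e u i = inner ℝ (toL2 (e i)) (toL2 u) := rfl

variable {e}

theorem coefficients_combination (he : Orthonormal ℝ fun i => toL2 (e i))
    (c : Space (k + 1)) : coefficients e (combination e c) = c := by
  ext i
  rw [coefficients_apply, combination_apply, map_sum]
  simp only [map_smul]
  exact he.inner_right_fintype c i

theorem combination_injective (he : Orthonormal ℝ fun i => toL2 (e i)) :
    Function.Injective (combination e) :=
  Function.LeftInverse.injective (coefficients_combination he)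

theorem inner_toL2_combination (he : Orthonormal ℝ fun i => toL2 (e i)) (b c : Space (k + 1)) :
    inner ℝ (toL2 (combination e b)) (toL2 (combination e c)) = inner ℝ b c := by
  rw [combination_apply e b, map_sum, sum_inner, PiLp.inner_apply]
  refine Finset.sum_congr rfl fun i _ => ?_
  rw [map_smul, real_inner_smul_left, ← coefficients_apply, coefficients_combination he]
  simp [mul_comm]

theorem norm_toL2_combination (he : Orthonormal ℝ fun i => toL2 (e i))
    (c : Space (k + 1)) : ‖toL2 (combination e c)‖ = ‖c‖ := by
  rw [norm_eq_sqrt_real_inner, inner_toL2_combination he, ← norm_eq_sqrt_real_inner]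

variable {μ : ℝ}

theorem combination_mem_eigenspace (hμ : ∀ i, e i ∈ eigenspace Ω m μ)
    (c : Space (k + 1)) : combination e c ∈ eigenspace Ω m μ := by
  rw [combination_apply]
  exact Submodule.sum_mem _ fun i _ => Submodule.smul_mem _ _ (hμ i)

theorem exists_combination_of_mem_eigenspace (he : Orthonormal ℝ fun i => toL2 (e i))
    (hμ : ∀ i, e i ∈ eigenspace Ω m μ)
    (hd : Module.finrank ℝ (eigenspace Ω m μ) = k + 1) {u : Hm0 Ω m}
    (hu : u ∈ eigenspace Ω m μ) : ∃ c, u = combination e c := by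
  have hfin : FiniteDimensional ℝ (eigenspace Ω m μ) :=
    FiniteDimensional.of_finrank_pos (by omega)
  let f : Space (k + 1) →ₗ[ℝ] eigenspace Ω m μ :=
    (combination e).toLinearMap.codRestrict _ (combination_mem_eigenspace hμ)
  have hf : Function.Injective f := fun x y h =>
    combination_injective he (congrArg Subtype.val h)
  have hs := (LinearMap.injective_iff_surjective_of_finrank_eq_finrank (f := f) (by simp [hd])).1 hf
  obtain ⟨c, hc⟩ := hs ⟨u, hu⟩
  exact ⟨c, (congrArg Subtype.val hc).symm⟩

/-- A combination lying in two eigenspaces with different eigenvalues is orthogonal to itself. -/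
theorem combination_mem_equilibria_iff (he : Orthonormal ℝ fun i => toL2 (e i))
    (hμ : ∀ i, e i ∈ eigenspace Ω m μ) {lam : ℝ} (c : Space (k + 1)) :
    combination e c ∈ equilibria Ω m lam ↔ c = 0 ∨ ‖c‖ ^ 2 = lam - μ := by
  rw [mem_equilibria_iff, norm_toL2_combination he]
  constructor
  · intro h
    by_contra! hc
    have h1 := inner_toL2_eq_zero_of_mem_eigenspace h (combination_mem_eigenspace hμ c)
      (fun h => hc.2 (by linarith))
    rw [inner_toL2_combination he, inner_self_eq_zero] at h1
    exact hc.1 h1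
  · rintro (rfl | h)
    · simp
    · rw [h, sub_sub_cancel]
      exact combination_mem_eigenspace hμ c

/-- The radius √(lam - μ) is the L²-norm of the centre, so closeness forces the eigenvalue μ, which
in turn fixes the norm of ψ. -/
theorem mem_equilibria_iff_of_close (he : Orthonormal ℝ fun i => toL2 (e i))
    (hμ : ∀ i, e i ∈ eigenspace Ω m μ) (hd : Module.finrank ℝ (eigenspace Ω m μ) = k + 1)
    {lam : ℝ} (hlam : μ < lam) {c : Space (k + 1)}
    (hc : ‖c‖ ^ 2 = lam - μ) {ψ : Hm0 Ω m}
    (hψ : ‖toL2 ψ - toL2 (combination e c)‖ < √(lam - μ)) :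
    ψ ∈ equilibria Ω m lam ↔ ψ ∈ combination e '' Metric.sphere 0 √(lam - μ) := by
  have hpos : 0 < lam - μ := sub_pos.2 hlam
  have hcn : ‖c‖ = √(lam - μ) := by rw [← hc, Real.sqrt_sq (norm_nonneg _)]
  constructor
  · intro h
    have hE := mem_equilibria_iff.1 h
    have hν := eigenvalue_eq_of_norm_sub_lt (combination_mem_eigenspace hμ c) hE
      (by rwa [norm_toL2_combination he, hcn])
    rw [hν] at hE
    obtain ⟨b, rfl⟩ := exists_combination_of_mem_eigenspace he hμ hd hE
    refine ⟨b, ?_, rfl⟩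
    rw [norm_toL2_combination he] at hν
    rw [mem_sphere_zero_iff_norm, ← Real.sqrt_sq (norm_nonneg b)]
    congr 1
    linarith
  · rintro ⟨b, hb, rfl⟩
    rw [mem_sphere_zero_iff_norm] at hb
    rw [combination_mem_equilibria_iff he hμ, hb, Real.sq_sqrt hpos.le]
    exact Or.inr rfl

theorem mem_kerV''_combination_iff (he : Orthonormal ℝ fun i => toL2 (e i))
    (hμ : ∀ i, e i ∈ eigenspace Ω m μ) (hd : Module.finrank ℝ (eigenspace Ω m μ) = k + 1)
    {lam : ℝ} (hlam : μ < lam) {c : Space (k + 1)}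
    (hc : ‖c‖ ^ 2 = lam - μ) {v : Hm0 Ω m} :
    v ∈ kerV'' lam (combination e c) ↔ ∃ b, inner ℝ c b = 0 ∧ v = combination e b := by
  have hc0 : c ≠ 0 := by
    rintro rfl
    simp at hc
    linarith
  rw [mem_kerV''_iff_of_mem_equilibria ((combination_mem_equilibria_iff he hμ c).2 (Or.inr hc))
    fun h => hc0 (combination_injective he (by rw [h, map_zero])), norm_toL2_combination he, hc,
    sub_sub_cancel]
  constructor
  · rintro ⟨hv, h0⟩
    obtain ⟨b, rfl⟩ := exists_combination_of_mem_eigenspace he hμ hd hv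
    exact ⟨b, by rwa [inner_toL2_combination he] at h0, rfl⟩
  · rintro ⟨b, h0, rfl⟩
    exact ⟨combination_mem_eigenspace hμ b, by rwa [inner_toL2_combination he]⟩

theorem finrank_kerV''_combination (he : Orthonormal ℝ fun i => toL2 (e i))
    (hμ : ∀ i, e i ∈ eigenspace Ω m μ) (hd : Module.finrank ℝ (eigenspace Ω m μ) = k + 1)
    {lam : ℝ} (hlam : μ < lam) {c : Space (k + 1)}
    (hc : ‖c‖ ^ 2 = lam - μ) : Module.finrank ℝ (kerV'' lam (combination e c)) = k := by
  have hc0 : c ≠ 0 := by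
    rintro rfl
    simp at hc
    linarith
  have hker : kerV'' lam (combination e c) = (ℝ ∙ c)ᗮ.map (combination e).toLinearMap := by
    ext v
    rw [mem_kerV''_combination_iff he hμ hd hlam hc, Submodule.mem_map]
    simp only [Submodule.mem_orthogonal_singleton_iff_inner_right]
    exact exists_congr fun b => and_congr_right fun _ => eq_comm
  have : Fact (Module.finrank ℝ (Space (k + 1)) = k + 1) := ⟨by simp⟩
  rw [hker, ← (Submodule.equivMapOfInjective _ (combination_injective he) _).finrank_eq]
  exact Submodule.finrank_orthogonal_span_singleton hc0

theorem isSmoothSubmanifold_combination_sphere (he : Orthonormal ℝ fun i => toL2 (e i))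
    {r : ℝ} (hr : 0 < r) :
    IsSmoothSubmanifold k (combination e '' Metric.sphere 0 r) :=
  isSmoothSubmanifold_image_sphere _ _ (coefficients_combination he) hr

theorem isPreconnected_combination_sphere (hk : 1 ≤ k) (r : ℝ) :
    IsPreconnected (combination e '' Metric.sphere 0 r) := by
  refine (isPreconnected_sphere ?_ _ _).image _ (combination e).continuous.continuousOn
  rw [← Module.finrank_eq_rank]
  simp only [finrank_euclideanSpace, Fintype.card_fin]
  exact_mod_cast (by omega : 1 < k + 1)

theorem combination_sphere_subset_equilibria (he : Orthonormal ℝ fun i => toL2 (e i))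
    (hμ : ∀ i, e i ∈ eigenspace Ω m μ) {lam : ℝ} (hlam : μ < lam) :
    combination e '' Metric.sphere 0 √(lam - μ) ⊆ equilibria Ω m lam := by
  rintro _ ⟨b, hb, rfl⟩
  rw [mem_sphere_zero_iff_norm] at hb
  rw [combination_mem_equilibria_iff he hμ, hb, Real.sq_sqrt (sub_pos.2 hlam).le]
  exact Or.inr rfl

/-- For k ≥ 1 the sphere is connected and contains c and -c; a connected set with two points has no
isolated point. -/
theorem branchingAt_combination (he : Orthonormal ℝ fun i => toL2 (e i))
    (hμ : ∀ i, e i ∈ eigenspace Ω m μ) {lam : ℝ} (hlam : μ < lam) (hk : 1 ≤ k) {c : Space (k + 1)}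
    (hc : ‖c‖ ^ 2 = lam - μ) : BranchingAt lam (combination e c) := by
  have hr : 0 < √(lam - μ) := Real.sqrt_pos.2 (sub_pos.2 hlam)
  have hcS : c ∈ Metric.sphere (0 : Space (k + 1)) √(lam - μ) := by
    rw [mem_sphere_zero_iff_norm, ← hc, Real.sqrt_sq (norm_nonneg _)]
  have hnt : (combination e '' Metric.sphere 0 √(lam - μ)).Nontrivial := by
    refine ⟨_, ⟨c, hcS, rfl⟩, _, ⟨-c, by simpa using hcS, rfl⟩, fun h => ?_⟩
    have h0 : c = 0 := by
      have h1 := combination_injective he h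
      rw [eq_neg_iff_add_eq_zero, ← two_smul ℝ] at h1
      simpa using h1
    rw [mem_sphere_zero_iff_norm, h0, norm_zero] at hcS
    exact hr.ne hcS
  refine ⟨(combination_mem_equilibria_iff he hμ c).2 (Or.inr hc), ?_⟩
  exact ((isPreconnected_combination_sphere hk _).preperfect_of_nontrivial hnt _
    ⟨c, hcS, rfl⟩).mono (principal_mono.2 (combination_sphere_subset_equilibria he hμ hlam))

theorem connectedComponentIn_combination (he : Orthonormal ℝ fun i => toL2 (e i))
    (hμ : ∀ i, e i ∈ eigenspace Ω m μ) (hd : Module.finrank ℝ (eigenspace Ω m μ) = k + 1)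
    {lam : ℝ} (hlam : μ < lam) (hk : 1 ≤ k)
    {c : Space (k + 1)} (hc : ‖c‖ ^ 2 = lam - μ) :
    connectedComponentIn (equilibria Ω m lam) (combination e c) =
      combination e '' Metric.sphere 0 √(lam - μ) := by
  set S := combination e '' Metric.sphere 0 √(lam - μ) with hS
  have hr : 0 < √(lam - μ) := Real.sqrt_pos.2 (sub_pos.2 hlam)
  have hcS : combination e c ∈ S :=
    ⟨c, by rw [mem_sphere_zero_iff_norm, ← hc, Real.sqrt_sq (norm_nonneg _)], rfl⟩
  have hSE : S ⊆ equilibria Ω m lam := combination_sphere_subset_equilibria he hμ hlam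
  refine Set.Subset.antisymm ?_
    ((isPreconnected_combination_sphere hk _).subset_connectedComponentIn hcS hSE)
  have hclosed : IsClosed S :=
    ((isCompact_sphere _ _).image (combination e).continuous).isClosed
  -- The sphere S is closed, and O shows it to be relatively open among the equilibria, so a
  -- connected set of equilibria meeting S stays in S.
  let O : Set (Hm0 Ω m) :=
    ⋃ b ∈ S, {ψ | ‖toL2 ψ - toL2 b‖ < √(lam - μ)}
  have hO : IsOpen O :=
    isOpen_biUnion fun b _ => isOpen_lt (by fun_prop) continuous_const
  have hSO : S ⊆ O := fun b hb => Set.mem_biUnion hb (by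
    change ‖toL2 b - toL2 b‖ < √(lam - μ)
    rwa [sub_self, norm_zero])
  have hOE : ∀ ψ ∈ O, ψ ∈ equilibria Ω m lam → ψ ∈ S := by
    intro ψ hψ hE
    obtain ⟨_, ⟨b, hb, rfl⟩, hlt⟩ := Set.mem_iUnion₂.1 hψ
    rw [mem_sphere_zero_iff_norm] at hb
    exact (mem_equilibria_iff_of_close he hμ hd hlam
      (by rw [hb, Real.sq_sqrt (sub_pos.2 hlam).le]) hlt).1 hE
  have hsub := connectedComponentIn_subset (equilibria Ω m lam) (combination e c)
  rcases isPreconnected_iff_subset_of_disjoint.1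
    (isPreconnected_connectedComponentIn (F := equilibria Ω m lam) (x := combination e c))
    O Sᶜ hO hclosed.isOpen_compl
    (fun ψ _ => (em (ψ ∈ S)).imp (fun h => hSO h) id)
    (by
      refine Set.eq_empty_of_forall_notMem fun ψ hψ => ?_
      exact hψ.2.2 (hOE ψ hψ.2.1 (hsub hψ.1))) with h | h
  · exact fun ψ hψ => hOE ψ (h hψ) (hsub hψ)
  · exact absurd hcS (h (mem_connectedComponentIn (hSE hcS)))

end Combination

/-! ### The resonance hypothesis -/

theorem finiteDimensional_kerV'' (hΩ : Bornology.IsBounded (Ω : Set (Space N))) (hm : 1 ≤ m)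
    {lam : ℝ} {ψ : Hm0 Ω m} (hψ : ψ ∈ equilibria Ω m lam) :
    FiniteDimensional ℝ (kerV'' lam ψ) := by
  by_cases h0 : ψ = 0
  · rw [h0, kerV''_zero]
    exact finiteDimensional_eigenspace hΩ hm lam
  · have := finiteDimensional_eigenspace hΩ hm (lam - ‖toL2 ψ‖ ^ 2)
    exact Submodule.finiteDimensional_of_le
      fun v hv => ((mem_kerV''_iff_of_mem_equilibria hψ h0).1 hv).1

theorem resonanceHypothesis (hΩ : Bornology.IsBounded (Ω : Set (Space N))) (hm : 1 ≤ m)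
    (lam : ℝ) : ResonanceHypothesis Ω m lam := by
  rintro ψ ⟨hψ, hacc⟩ k hk hker
  have h0 : ψ ≠ 0 := by
    rintro rfl
    exact not_accPt_zero_equilibria hΩ hm lam hacc
  have hn : 0 < ‖toL2 ψ‖ ^ 2 := by
    have : toL2 ψ ≠ 0 := fun h => h0 (toL2_injective (by rw [h, map_zero]))
    positivity
  obtain ⟨μ, hμ⟩ : ∃ μ, μ = lam - ‖toL2 ψ‖ ^ 2 := ⟨_, rfl⟩
  have hlam : μ < lam := by linarith
  have hE : ψ ∈ eigenspace Ω m μ := hμ ▸ mem_equilibria_iff.1 hψ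
  have := finiteDimensional_eigenspace (Ω := Ω) (m := m) hΩ hm μ
  have hnt : Nontrivial (eigenspace Ω m μ) :=
    ⟨⟨ψ, hE⟩, 0, fun h => h0 (congrArg Subtype.val h)⟩
  obtain ⟨d, hd⟩ := Nat.exists_eq_add_one_of_ne_zero
    (Module.finrank_pos (R := ℝ) (M := eigenspace Ω m μ)).ne'
  obtain ⟨e, he, ho⟩ := exists_orthonormal_eigenspace hd
  obtain ⟨c, rfl⟩ := exists_combination_of_mem_eigenspace ho he hd hE
  have hc : ‖c‖ ^ 2 = lam - μ := by
    rw [norm_toL2_combination ho] at hμ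
    linarith
  -- The eigenspace has dimension d + 1 and the sphere dimension d, which is also that of the
  -- kernel.
  obtain rfl : d = k := (finrank_kerV''_combination ho he hd hlam hc).symm.trans hker
  have hr : 0 < √(lam - μ) := Real.sqrt_pos.2 (sub_pos.2 hlam)
  have hU : IsOpen {χ : Hm0 Ω m | ‖toL2 χ - toL2 (combination e c)‖ < √(lam - μ)} :=
    isOpen_lt (by fun_prop) continuous_const
  refine ⟨_, hU, by simpa using hr, ?_⟩
  have heq : equilibria Ω m lam ∩ {χ | ‖toL2 χ - toL2 (combination e c)‖ < √(lam - μ)} =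
      combination e '' Metric.sphere 0 √(lam - μ) ∩
        {χ | ‖toL2 χ - toL2 (combination e c)‖ < √(lam - μ)} := by
    ext χ
    exact and_congr_left fun h => mem_equilibria_iff_of_close ho he hd hlam hc h
  rw [heq]
  exact (isSmoothSubmanifold_combination_sphere ho hr).inter_isOpen hU

end NonlocalResonance

end

theorem mainTheorem5 {N : ℕ} (Ω : TopologicalSpace.Opens (NonlocalResonance.Space N))
    (hΩ : Bornology.IsBounded (Ω : Set (NonlocalResonance.Space N)))
    (m : ℕ) (hm : 1 ≤ m)
    (lamL : ℝ) (hL : NonlocalResonance.IsDirichletEigenvalue Ω m lamL) :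
    -- the resonance branching hypothesis; all kernels are finite-dimensional
    NonlocalResonance.ResonanceHypothesis Ω m lamL ∧
    (∀ ψ ∈ NonlocalResonance.equilibria Ω m lamL,
      FiniteDimensional ℝ (NonlocalResonance.kerV'' lamL ψ)) ∧
    -- the formula for the linearization
    (∀ (ψ : NonlocalResonance.Hm0 Ω m) (φ : 𝓓(Ω, ℝ)),
      DifferentiableAt ℝ
        (fun u : NonlocalResonance.Hm0 Ω m => NonlocalResonance.opV' lamL u φ) ψ ∧
      ∀ v : NonlocalResonance.Hm0 Ω m,
        NonlocalResonance.opV'' lamL ψ v φ =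
          -NonlocalResonance.pairing v (NonlocalResonance.polyLaplacian Ω m φ)
            + lamL * NonlocalResonance.pairing v φ
            - 2 * NonlocalResonance.pairing ψ φ * NonlocalResonance.integralMul ψ v
            - NonlocalResonance.pairing v φ * NonlocalResonance.integralMul ψ ψ) ∧
    -- equilibria built from an eigenspace of dimension `k + 1 ≥ 2`
    ∀ (lamJ : ℝ) (k : ℕ) (e : Fin (k + 1) → NonlocalResonance.Hm0 Ω m),
      lamJ < lamL → 1 ≤ k →
      Module.finrank ℝ (NonlocalResonance.eigenspace Ω m lamJ) = k + 1 →
      (∀ i, e i ∈ NonlocalResonance.eigenspace Ω m lamJ) →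
      Orthonormal ℝ (fun i => NonlocalResonance.toL2 (e i)) →
      ∀ S : Set (NonlocalResonance.Hm0 Ω m),
      S = {ψ | ∃ c : Fin (k + 1) → ℝ, ∑ i, c i ^ 2 = lamL - lamJ ∧ ψ = ∑ i, c i • e i} →
        (∀ c : Fin (k + 1) → ℝ, ∑ i, c i • e i ∈ NonlocalResonance.equilibria Ω m lamL ↔
          c = 0 ∨ ∑ i, c i ^ 2 = lamL - lamJ) ∧
        NonlocalResonance.IsSmoothSubmanifold k S ∧
        ∀ c : Fin (k + 1) → ℝ, ∑ i, c i ^ 2 = lamL - lamJ →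
          NonlocalResonance.BranchingAt lamL (∑ i, c i • e i) ∧
          -- near the given equilibrium (in `L²`), the equilibria are exactly the points of `S`
          (∃ ε > 0, ∀ ψ : NonlocalResonance.Hm0 Ω m,
            ‖NonlocalResonance.toL2 ψ - NonlocalResonance.toL2 (∑ i, c i • e i)‖ < ε →
              (ψ ∈ NonlocalResonance.equilibria Ω m lamL ↔ ψ ∈ S)) ∧
          connectedComponentIn (NonlocalResonance.equilibria Ω m lamL) (∑ i, c i • e i) = S ∧
          -- the kernel of the linearization
          (∀ v : NonlocalResonance.Hm0 Ω m,
            v ∈ NonlocalResonance.kerV'' lamL (∑ i, c i • e i) ↔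
              ∃ b : Fin (k + 1) → ℝ, ∑ i, b i * c i = 0 ∧ v = ∑ i, b i • e i) ∧
          Module.finrank ℝ (NonlocalResonance.kerV'' lamL (∑ i, c i • e i)) = k := by
  refine ⟨NonlocalResonance.resonanceHypothesis hΩ hm lamL,
    fun ψ hψ => NonlocalResonance.finiteDimensional_kerV'' hΩ hm hψ,
    fun ψ φ => ⟨?_, fun v => NonlocalResonance.opV''_apply lamL ψ v φ⟩, ?_⟩
  · obtain ⟨D, hD, -⟩ := NonlocalResonance.hasFDerivAt_opV' lamL ψ φ
    exact hD.differentiableAt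
  intro lamJ k e hlam hk hd he ho S hS
  -- Plain coefficient functions are moved to `EuclideanSpace`, where the sum of squares is a norm
  -- and S is the image of a round sphere.
  have hsum : ∀ c : Fin (k + 1) → ℝ, ∑ i, c i • e i =
      NonlocalResonance.combination e (WithLp.toLp 2 c) := fun c =>
    (NonlocalResonance.combination_apply e _).symm
  have hnorm : ∀ c : Fin (k + 1) → ℝ, ∑ i, c i ^ 2 = ‖WithLp.toLp 2 c‖ ^ 2 := fun c =>
    (EuclideanSpace.real_norm_sq_eq (WithLp.toLp 2 c)).symm
  have hS' : S = NonlocalResonance.combination e '' Metric.sphere 0 √(lamL - lamJ) := by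
    rw [hS]
    ext ψ
    simp only [Set.mem_image, mem_sphere_zero_iff_norm]
    constructor
    · rintro ⟨c, hc, rfl⟩
      exact ⟨WithLp.toLp 2 c, by rw [← hc, hnorm, Real.sqrt_sq (norm_nonneg _)], (hsum c).symm⟩
    · rintro ⟨c, hc, rfl⟩
      refine ⟨c.ofLp, ?_, NonlocalResonance.combination_apply e c⟩
      rw [hnorm, WithLp.toLp_ofLp, hc, Real.sq_sqrt (sub_pos.2 hlam).le]
  have hr : 0 < √(lamL - lamJ) := Real.sqrt_pos.2 (sub_pos.2 hlam)
  refine ⟨fun c => ?_, ?_, fun c hc => ?_⟩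
  · rw [hsum, hnorm, NonlocalResonance.combination_mem_equilibria_iff ho he, WithLp.toLp_eq_zero]
  · rw [hS']
    exact NonlocalResonance.isSmoothSubmanifold_combination_sphere ho hr
  rw [hnorm] at hc
  rw [hsum, hS']
  refine ⟨NonlocalResonance.branchingAt_combination ho he hlam hk hc,
    ⟨_, hr, fun ψ hψ => NonlocalResonance.mem_equilibria_iff_of_close ho he hd hlam hc hψ⟩,
    NonlocalResonance.connectedComponentIn_combination ho he hd hlam hk hc, fun v => ?_,
    NonlocalResonance.finrank_kerV''_combination ho he hd hlam hc⟩
  rw [NonlocalResonance.mem_kerV''_combination_iff ho he hd hlam hc]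
  constructor
  · rintro ⟨b, hb, rfl⟩
    exact ⟨b.ofLp, by simpa [PiLp.inner_apply] using hb, NonlocalResonance.combination_apply e b⟩
  · rintro ⟨b, hb, rfl⟩
    exact ⟨WithLp.toLp 2 b, by simpa [PiLp.inner_apply] using hb, hsum b⟩
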